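/- **Setting.** Let $0\le T_{\min}\le T_{\max}<\infty$. Consider the impulsive system with constant delays $h_c\in\mathbb R_{>0}$, $h_d\in\mathbb Z_{\ge0}$ $$\begin{aligned} \dot x(t_k+\tau)&=A(\tau)x(t_k+\tau)+G_c(\tau)x(t_k+\tau-h_c)+E_c(\tau)w_c(t_k+\tau),\\ z_c(t_k+\tau)&=C_cx(t_k+\tau)+H_cx(t_k+\tau-h_c)+F_cw_c(t_k+\tau),&&\tau\in(0,T_k],\ k\ge0,\\ x(t_k^+)&=Jx(t_k)+G_dx(t_{k-h_d})+E_dw_d(k),\\ z_d(k)&=C_dx(t_k)+H_dx(t_{k-h_d})+F_dw_d(k),&&k\ge1,\\ x(s)&=\phi_0(s),&&s\in[-h_c,0], \end{aligned}$$ with $x\in\mathbb R^n$, $\phi_0\in C([-h_c,0],\mathbb R^n)$, and $A,G_c,E_c$ continuous on $[0,T_{\max}]$; solutions are left-continuous and satisfy the differential equation in integrated form. The impulse times satisfy $t_0=0$, $T_k:=t_{k+1}-t_k>0$, $t_k\to\infty$; the values $x(t_{-j})$ for $1\le j\le h_d-1$ are arbitrary prescribed initial data $\psi_j$, and $\|x_0\|:=\sup_{[-h_c,0]}\|\phi_0\|+\sum_{1\le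 j<h_d}\|\psi_j\|$. The range dwell-time condition $[T_{\min},T_{\max}]$ means $T_k\in[T_{\min},T_{\max}]$ for all $k\ge 0$. *Internally positive* means: for all delays and all impulse-time sequences satisfying the range dwell-time condition, nonnegative initial data and nonnegative inputs give $x(t)\ge0$ for $t\ge0$, $z_c(t)\ge0$ for $t>0$ and $z_d(k)\ge0$ for $k\ge1$. *Scalings.* For a delay $h_c$ and an impulse-time sequence, $\mathcal S_c$ is the set of the maps $S=\mathrm{diag}(\mu_c):[0,T_{\max}]\to\mathbb R^{n\times n}$ with $\mu_c(\tau)>0$ componentwise such that multiplication by $\tilde S(t):=S(t-t_k)$, $t\in(t_k,t_{k+1}]$, commutes with the delay operator $(\Delta_cz)(t)=z(t-h_c)$ (and $0$ for $t\le h_c$) on $L_1((0,\infty),\mathbb R^n)$. (Constant positive $\mu_c$ belong to it for every delay and every sequence.) *Stability and gain.* For a family $\mathcal T$ of impulse-time sequences, the system is *asymptotically stable* over $\mathcal T$ if, for zero inputs, for every $e>0$ there is $\delta>0$ such that for all sequences in $\mathcal T$, $\|x_0\|<\delta$ implies $\|x(t)\|<e$ for all $t\ge0$, and every solution tends to $0$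 as $t\to\infty$. It has *hybrid $L_1/\ell_1$-gain at most $\gamma$* over $\mathcal T$ if there is a strictly increasing function $v$ on $[0,\infty)$ with $v(0)=0$, $v(s)\to\infty$ as $s\to\infty$, such that for all sequences in $\mathcal T$, all initial data and all $w_c\in L_1$, $w_d\in\ell_1$ one has $z_c\in L_1$, $z_d\in\ell_1$ and $$\|z_c\|_{L_1}+\|z_d\|_{\ell_1}\le\gamma(\|w_c\|_{L_1}+\|w_d\|_{\ell_1})+v(\|x_0\|),$$ where the norms are built on the vector $1$-norm and discrete signals are indexed by $k\ge1$. **Theorem (Range dwell-time, delays).** Assume that the system is internally positive and that there exist a differentiable $\zeta:[0,T_{\max}]\to\mathbb R^n$ with $\zeta(0)>0$, a function $\mu_c:[0,T_{\max}]\to\mathbb R^n$ and scalars $\epsilon,\gamma>0$ such that, componentwise, for all $\tau\in[0,T_{\max}]$ and all $\theta\in[T_{\min},T_{\max}]$, $$\begin{aligned} \dot\zeta(\tau)^T+\zeta(\tau)^TA(\tau)+\mu_c(\tau)^T+\mathbf 1^TC_c&\le0,\\ \zeta(\tau)^TG_c(\tau)-\mu_c(\tau)^T+\mathbf 1^TH_c&\le0,\\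 \zeta(\tau)^TE_c(\tau)+\mathbf 1^TF_c&\le\gamma\mathbf 1^T,\\ -\zeta(\theta)^T+\zeta(0)^T(J+G_d)+\mathbf 1^T(C_d+H_d)&\le-\epsilon\mathbf 1^T,\\ \zeta(0)^TE_d+\mathbf 1^TF_d&\le\gamma\mathbf 1^T. \end{aligned}$$ Then for all delays $h_c\in\mathbb R_{>0}$ and $h_d\in\mathbb Z_{\ge0}$, and every family $\mathcal T$ of impulse-time sequences satisfying the range dwell-time condition $[T_{\min},T_{\max}]$ such that $\mathrm{diag}(\mu_c)\in\mathcal S_c$ for $h_c$ and every sequence in $\mathcal T$, the system is asymptotically stable over $\mathcal T$ and the map $(w_c,w_d)\mapsto(z_c,z_d)$ has a hybrid $L_1/\ell_1$-gain of at most $\gamma$ over $\mathcal T$. In particular, if $\mathrm{diag}(\mu_c)\in\mathcal S_c$ for all delays $h_c>0$ and all such sequences, this holds under the range dwell-time condition for all delays. -/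

import Mathlib

open MeasureTheory Set Filter Topology
open scoped Matrix

noncomputable section

namespace DelayImpulsive

/-- The `1`-norm of a real vector. -/
def norm1 {m : ℕ} (v : Fin m → ℝ) : ℝ := ∑ i, |v i|

/-- The matrices of a linear impulsive system with a delay in the continuous-time and in the
discrete-time dynamics. `A`, `Gc`, `Ec` are functions of the timer `τ`, the time elapsed since the
last impulse. -/
structure Sys (n pc pd qc qd : ℕ) where
  A : ℝ → Matrix (Fin n) (Fin n) ℝ
  Gc : ℝ → Matrix (Fin n) (Fin n) ℝ
  Ec : ℝ → Matrix (Fin n) (Fin pc) ℝ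
  Cc : Matrix (Fin qc) (Fin n) ℝ
  Hc : Matrix (Fin qc) (Fin n) ℝ
  Fc : Matrix (Fin qc) (Fin pc) ℝ
  J : Matrix (Fin n) (Fin n) ℝ
  Gd : Matrix (Fin n) (Fin n) ℝ
  Ed : Matrix (Fin n) (Fin pd) ℝ
  Cd : Matrix (Fin qd) (Fin n) ℝ
  Hd : Matrix (Fin qd) (Fin n) ℝ
  Fd : Matrix (Fin qd) (Fin pd) ℝ

/-- Impulse-time sequences `0 = t 0 < t 1 < ⋯ → ∞` whose dwell-times `t (k + 1) - t k` all lie in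
`[Tmin, Tmax]`. -/
def rangeDwell (Tmin Tmax : ℝ) : Set (ℕ → ℝ) :=
  {t | t 0 = 0 ∧ (∀ k, 0 < t (k + 1) - t k) ∧ (∀ k, t (k + 1) - t k ∈ Icc Tmin Tmax) ∧
    Tendsto t atTop atTop}

/-- The timer at time `s > 0`: it equals `s - t k` for `s ∈ (t k, t (k + 1)]`. -/
def timer (t : ℕ → ℝ) (s : ℝ) : ℝ := s - sSup {r | ∃ k, r = t k ∧ r < s}

/-- The constant-delay operator on signals over `(0, ∞)`, with zero past. -/
def delayOp {n : ℕ} (h : ℝ) (z : ℝ → Fin n → ℝ) (s : ℝ) : Fin n → ℝ :=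
  if h < s then z (s - h) else 0

/-- The timer-dependent scalings for the delay `h` and the impulse-time sequence `t`:
the `μ` such that `diag (μ τ)` is positive definite for `τ ∈ [0, Tmax]` and the multiplication
operator by `diag (μ (timer))` commutes with the delay operator on `L¹`-signals. -/
def timerScalings (n : ℕ) (Tmax h : ℝ) (t : ℕ → ℝ) : Set (ℝ → Fin n → ℝ) :=
  {μ | (∀ τ ∈ Icc 0 Tmax, ∀ i, 0 < μ τ i) ∧
    ∀ z : ℝ → Fin n → ℝ, IntegrableOn z (Ioi 0) →
      (fun s => Matrix.diagonal (μ (timer t s)) *ᵥ delayOp h z s)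
        =ᵐ[volume.restrict (Ioi 0)]
      delayOp h (fun s => Matrix.diagonal (μ (timer t s)) *ᵥ z s)}

/-- The sample `x (t_{k - hd})`. For negative indices, `x (t_{-j})` is the prescribed initial
datum `ψ j`. -/
def sample {n : ℕ} (t : ℕ → ℝ) (hd : ℕ) (ψ : ℕ → Fin n → ℝ) (x : ℝ → Fin n → ℝ) (k : ℕ) :
    Fin n → ℝ :=
  if hd ≤ k then x (t (k - hd)) else ψ (hd - k)

/-- Size of the initial data: the supremum of `‖φ‖` over `[-hc, 0]` plus the sum of the norms of
the discrete initial data that the system uses. -/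
def initNorm {n : ℕ} (hc : ℝ) (hd : ℕ) (φ : ℝ → Fin n → ℝ) (ψ : ℕ → Fin n → ℝ) : ℝ :=
  sSup ((fun s => ‖φ s‖) '' Icc (-hc) 0) + ∑ j ∈ Finset.Ico 1 hd, ‖ψ j‖

namespace Sys

variable {n pc pd qc qd : ℕ}

/-- Right-hand side of the differential equation on `(t k, t (k + 1)]`. -/
def flow (S : Sys n pc pd qc qd) (hc : ℝ) (t : ℕ → ℝ) (wc : ℝ → Fin pc → ℝ) (x : ℝ → Fin n → ℝ)
    (k : ℕ) (s : ℝ) : Fin n → ℝ :=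
  S.A (s - t k) *ᵥ x s + S.Gc (s - t k) *ᵥ x (s - hc) + S.Ec (s - t k) *ᵥ wc s

/-- The value `x (t_k⁺)`; there is no jump at `t 0 = 0`. -/
def post (S : Sys n pc pd qc qd) (hd : ℕ) (t : ℕ → ℝ) (ψ : ℕ → Fin n → ℝ) (wd : ℕ → Fin pd → ℝ)
    (x : ℝ → Fin n → ℝ) (k : ℕ) : Fin n → ℝ :=
  if k = 0 then x 0 else S.J *ᵥ x (t k) + S.Gd *ᵥ sample t hd ψ x k + S.Ed *ᵥ wd k

/-- The continuous-time performance output (at times `s > 0`). -/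
def zc (S : Sys n pc pd qc qd) (hc : ℝ) (wc : ℝ → Fin pc → ℝ) (x : ℝ → Fin n → ℝ) (s : ℝ) :
    Fin qc → ℝ :=
  S.Cc *ᵥ x s + S.Hc *ᵥ x (s - hc) + S.Fc *ᵥ wc s

/-- The discrete-time performance output (for `k ≥ 1`). -/
def zd (S : Sys n pc pd qc qd) (hd : ℕ) (t : ℕ → ℝ) (ψ : ℕ → Fin n → ℝ) (wd : ℕ → Fin pd → ℝ)
    (x : ℝ → Fin n → ℝ) (k : ℕ) : Fin qd → ℝ :=
  S.Cd *ᵥ x (t k) + S.Hd *ᵥ sample t hd ψ x k + S.Fd *ᵥ wd k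

/-- `x` is the (Carathéodory, left-continuous) solution on `[-hc, ∞)` of the impulsive system with
delays `hc`, `hd`, impulse times `t`, continuous initial function `φ`, discrete initial data `ψ`
and inputs `wc`, `wd`. -/
structure IsSolution (S : Sys n pc pd qc qd) (hc : ℝ) (hd : ℕ) (t : ℕ → ℝ)
    (φ : ℝ → Fin n → ℝ) (ψ : ℕ → Fin n → ℝ) (wc : ℝ → Fin pc → ℝ) (wd : ℕ → Fin pd → ℝ)
    (x : ℝ → Fin n → ℝ) : Prop where
  phi_cont : ContinuousOn φ (Icc (-hc) 0)
  init : ∀ s ∈ Icc (-hc) 0, x s = φ s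
  flow_integrable : ∀ k, IntervalIntegrable (S.flow hc t wc x k) volume (t k) (t (k + 1))
  flow_eq : ∀ k, ∀ s ∈ Ioc (t k) (t (k + 1)),
    x s = S.post hd t ψ wd x k + ∫ r in (t k)..s, S.flow hc t wc x k r

/-- Internal positivity (for all delays, along the impulse-time sequences of a class `𝒯`):
nonnegative initial data and inputs give nonnegative states and outputs. -/
def InternallyPositive (S : Sys n pc pd qc qd) (𝒯 : Set (ℕ → ℝ)) : Prop :=
  ∀ hc : ℝ, 0 < hc → ∀ hd : ℕ, ∀ t ∈ 𝒯, ∀ φ ψ wc wd x, S.IsSolution hc hd t φ ψ wc wd x →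
    LocallyIntegrableOn wc (Ici 0) →
    (∀ s ∈ Icc (-hc) 0, 0 ≤ φ s) → (∀ j, 0 ≤ ψ j) → (∀ s, 0 < s → 0 ≤ wc s) →
    (∀ k, 1 ≤ k → 0 ≤ wd k) →
    (∀ s, 0 ≤ s → 0 ≤ x s) ∧ (∀ s, 0 < s → 0 ≤ S.zc hc wc x s) ∧
      (∀ k, 1 ≤ k → 0 ≤ S.zd hd t ψ wd x k)

/-- Asymptotic stability of the system without inputs: Lyapunov stability (uniform over `𝒯`) and
global attractivity, for all impulse-time sequences in `𝒯`. -/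
def AsymptoticallyStable (S : Sys n pc pd qc qd) (hc : ℝ) (hd : ℕ) (𝒯 : Set (ℕ → ℝ)) : Prop :=
  (∀ e : ℝ, 0 < e → ∃ δ : ℝ, 0 < δ ∧ ∀ t ∈ 𝒯, ∀ φ ψ x,
    S.IsSolution hc hd t φ ψ (fun _ => 0) (fun _ => 0) x → initNorm hc hd φ ψ < δ →
      ∀ s, 0 ≤ s → ‖x s‖ < e) ∧
  ∀ t ∈ 𝒯, ∀ φ ψ x, S.IsSolution hc hd t φ ψ (fun _ => 0) (fun _ => 0) x →
    Tendsto x atTop (𝓝 0)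

/-- The map `(wc, wd) ↦ (zc, zd)` has a hybrid `L₁/ℓ₁`-gain of at most `γ`, for all impulse-time
sequences in `𝒯`. -/
def HasHybridGain (S : Sys n pc pd qc qd) (hc : ℝ) (hd : ℕ) (𝒯 : Set (ℕ → ℝ)) (γ : ℝ) : Prop :=
  ∃ v : ℝ → ℝ, StrictMonoOn v (Ici 0) ∧ v 0 = 0 ∧ Tendsto v atTop atTop ∧
    ∀ t ∈ 𝒯, ∀ φ ψ wc wd x, S.IsSolution hc hd t φ ψ wc wd x →
      IntegrableOn wc (Ioi 0) → Summable (fun k => norm1 (wd (k + 1))) →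
      IntegrableOn (S.zc hc wc x) (Ioi 0) ∧
      Summable (fun k => norm1 (S.zd hd t ψ wd x (k + 1))) ∧
      (∫ s in Ioi 0, norm1 (S.zc hc wc x s)) + ∑' k, norm1 (S.zd hd t ψ wd x (k + 1)) ≤
        γ * ((∫ s in Ioi 0, norm1 (wc s)) + ∑' k, norm1 (wd (k + 1))) + v (initNorm hc hd φ ψ)

end Sys

end DelayImpulsive

end

/-!
# Stability and hybrid gain of internally positive impulsive systems with delays

Along a nonnegative solution the copositive functional

  `ζ(τ) ⬝ᵥ x(s) + ∫ r in (s - hc)..s, M(r) ⬝ᵥ x(r) + ∑ (last hd samples) μd ⬝ᵥ x(t j)`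

is dissipated: between impulses it decreases at least at the rate `1 ⬝ᵥ zc - γ 1 ⬝ᵥ wc`, and across
an impulse at least by `ε 1 ⬝ᵥ x(t k) + 1 ⬝ᵥ zd - γ 1 ⬝ᵥ wd`. Right after an impulse it is nonnegative,
because `ζ(0) > 0`; nothing is known about the sign of `ζ` elsewhere. Summing over the intervals gives
`Certificate.exists_dissipation_bound`, hence the gain for nonnegative data, and the summability of
the samples `x(t k)`. A general solution is the difference of two nonnegative ones
(`IsSolution.exists_sub_eq`), which needs the existence of solutions (`exists_isSolution`).

Three points need care.

* The scaling `μc` is an arbitrary function, possibly neither measurable nor bounded. Commutation with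
  the delay operator makes it invariant under the delay almost everywhere, so that it can be replaced
  by a bounded measurable invariant multiplier `M`, a supremum of translates of its lower bound, the
  positive part of `ζᵀ Gc + 1ᵀ Hc` (`timerScalings.exists_multiplier`).
* The function `ζ` is differentiable, but its derivative need not be integrable, while the state is
  only absolutely continuous. The product rule is therefore used as an inequality
  (`mul_sub_mul_le_integral`), which needs only an integrable upper bound of the derivative.
* Internal positivity is a property of trajectories. Testing it on suitable initial data gives
  `Gd, Hd ≥ 0`, which makes the discrete storage nonnegative, and `Gc ≥ 0`. From the latter,
  Grönwall's inequality backward in time bounds an unforced nonnegative state between two impulses by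
  its value at the next one (`exists_one_dotProduct_le`). Stability and attractivity follow from the
  summability of the samples.
-/

namespace DelayImpulsive

/-! ### Integral inequalities -/

/-- Grönwall's inequality in integral form. -/
theorem le_mul_exp_of_le_integral {q : ℝ → ℝ} {a b c K : ℝ} (hK : 0 ≤ K)
    (hq : ContinuousOn q (Icc a b)) (h : ∀ s ∈ Icc a b, q s ≤ c + K * ∫ r in a..s, q r) :
    ∀ s ∈ Icc a b, q s ≤ c * Real.exp (K * (s - a)) := by
  intro s hs
  have hab : a ≤ b := hs.1.trans hs.2
  have hd : ∀ x ∈ Ico a b, HasDerivWithinAt (fun s => c + K * ∫ r in a..s, q r) (K * q x)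
      (Ici x) x := by
    intro x hx
    have hx' : x ∈ Icc a b := Ico_subset_Icc_self hx
    refine (HasDerivWithinAt.const_mul K ?_).const_add c
    have hnhds : Icc a b ∈ 𝓝[>] x := mem_of_superset (Ioo_mem_nhdsGT hx.2)
      fun z hz => ⟨hx.1.trans hz.1.le, hz.2.le⟩
    refine intervalIntegral.integral_hasDerivWithinAt_right ?_ ?_ ?_ (s := Ici x) (t := Ioi x)
    · exact (hq.mono (by rw [uIcc_of_le hx.1]; exact Icc_subset_Icc_right hx.2.le)).intervalIntegrable
    · exact ⟨Icc a b, hnhds, hq.aestronglyMeasurable measurableSet_Icc⟩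
    · exact (hq x hx').mono_of_mem_nhdsWithin hnhds
  have hc : ContinuousOn (fun s => c + K * ∫ r in a..s, q r) (Icc a b) := by
    refine continuousOn_const.add (continuousOn_const.mul ?_)
    have := intervalIntegral.continuousOn_primitive_interval (μ := volume) (f := q) (a := a) (b := b)
      (by rw [uIcc_of_le hab]; exact hq.integrableOn_Icc)
    rwa [uIcc_of_le hab] at this
  have key := le_gronwallBound_of_liminf_deriv_right_le (δ := c) (K := K) (ε := 0) hc
    (fun x hx r hr => (hd x hx).liminf_right_slope_le hr) (by simp)
    (fun x hx => by
      have := mul_le_mul_of_nonneg_left (h x (Ico_subset_Icc_self hx)) hK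
      simpa using this) s hs
  rw [gronwallBound_ε0] at key
  exact (h s hs).trans key

/-- Grönwall's inequality in integral form, backward in time. -/
theorem le_mul_exp_of_le_integral_backward {q : ℝ → ℝ} {a b c K : ℝ} (hK : 0 ≤ K)
    (hq : ContinuousOn q (Icc a b)) (h : ∀ s ∈ Icc a b, q s ≤ c + K * ∫ r in s..b, q r) :
    ∀ s ∈ Icc a b, q s ≤ c * Real.exp (K * (b - s)) := by
  intro s hs
  have := le_mul_exp_of_le_integral (q := fun s => q (-s)) (a := -b) (b := -a) (c := c) hK
    (hq.comp continuousOn_neg fun x hx => ⟨by linarith [hx.2], by linarith [hx.1]⟩)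
    (fun s hs => by
      have := h (-s) ⟨by linarith [hs.2], by linarith [hs.1]⟩
      simpa using this) (-s) ⟨by linarith [hs.2], by linarith [hs.1]⟩
  simp only [neg_neg] at this
  convert this using 3
  ring

/-- An inequality between the increments of two functions that holds over all short subintervals
holds over the whole interval. -/
theorem sub_le_sub_of_local {D H : ℝ → ℝ} {a b δ : ℝ} (hab : a ≤ b) (hδ : 0 < δ)
    (h : ∀ s ∈ Icc a b, ∀ s' ∈ Icc a b, s ≤ s' → s' - s < δ → D s' - D s ≤ H s' - H s) :
    D b - D a ≤ H b - H a := by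
  obtain ⟨N, hN⟩ := exists_nat_gt ((b - a) / δ)
  have hN0 : (0 : ℝ) < N := lt_of_le_of_lt (div_nonneg (by linarith) hδ.le) hN
  have hstep : (b - a) / N < δ := by
    rw [div_lt_iff₀ hδ] at hN
    rw [div_lt_iff₀ hN0]; linarith
  have hstep0 : 0 ≤ (b - a) / N := div_nonneg (by linarith) hN0.le
  have hmem : ∀ j : ℕ, j ≤ N → a + j * ((b - a) / N) ∈ Icc a b := by
    intro j hj
    refine ⟨by have := mul_nonneg (Nat.cast_nonneg (α := ℝ) j) hstep0; linarith, ?_⟩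
    have : (j : ℝ) * ((b - a) / N) ≤ N * ((b - a) / N) :=
      mul_le_mul_of_nonneg_right (by exact_mod_cast hj) hstep0
    rw [mul_div_cancel₀ _ hN0.ne'] at this
    linarith
  have : ∀ j : ℕ, j ≤ N → D (a + j * ((b - a) / N)) - D a ≤ H (a + j * ((b - a) / N)) - H a := by
    intro j
    induction j with
    | zero => simp
    | succ j ih =>
      intro hj
      have h1 := ih (by omega)
      have h2 := h _ (hmem j (by omega)) _ (hmem (j + 1) hj) (by push_cast; linarith)
        (by push_cast; linarith)
      linarith
  have := this N le_rfl
  rw [mul_div_cancel₀ _ hN0.ne'] at this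
  simpa using this

/-- The product rule, as an inequality: `x` is absolutely continuous and nonnegative with
derivative `f`, and the increments of `ζ` are bounded above by those of a primitive of `U`. No
integrability of a derivative of `ζ` is needed. -/
theorem mul_sub_mul_le_integral {ζ U x f : ℝ → ℝ} {a b : ℝ} (hab : a ≤ b)
    (hζ : ContinuousOn ζ (Icc a b)) (hU : IntervalIntegrable U volume a b)
    (hUζ : ∀ s ∈ Icc a b, ∀ s' ∈ Icc a b, s ≤ s' → ζ s' - ζ s ≤ ∫ r in s..s', U r)
    (hf : IntervalIntegrable f volume a b) (hx : ∀ s ∈ Icc a b, x s = x a + ∫ r in a..s, f r)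
    (hx0 : ∀ s ∈ Icc a b, 0 ≤ x s) :
    ζ b * x b - ζ a * x a ≤ ∫ r in a..b, (U r * x r + ζ r * f r) := by
  have hxc : ContinuousOn x (Icc a b) := by
    have := intervalIntegral.continuousOn_primitive_interval' hf left_mem_uIcc
    rw [uIcc_of_le hab] at this
    exact (continuousOn_const.add this).congr hx
  have hUx : IntervalIntegrable (fun r => U r * x r) volume a b :=
    hU.mul_continuousOn (by rwa [uIcc_of_le hab])
  have hζf : IntervalIntegrable (fun r => ζ r * f r) volume a b :=
    hf.continuousOn_mul (by rwa [uIcc_of_le hab])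
  have hI := hUx.add hζf
  have hV : IntervalIntegrable (fun r => |U r| + |f r|) volume a b := hU.abs.add hf.abs
  have hsub : ∀ {g : ℝ → ℝ}, IntervalIntegrable g volume a b → ∀ s ∈ Icc a b, ∀ s' ∈ Icc a b,
      IntervalIntegrable g volume s s' := fun hg s hs s' hs' =>
    hg.mono_set (by rw [uIcc_of_le hab]; exact uIcc_subset_Icc hs hs')
  have hdiff : ∀ {g : ℝ → ℝ}, IntervalIntegrable g volume a b → ∀ s ∈ Icc a b, ∀ s' ∈ Icc a b,
      (∫ r in a..s', g r) - ∫ r in a..s, g r = ∫ r in s..s', g r := fun hg s hs s' hs' =>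
    intervalIntegral.integral_interval_sub_left (hsub hg a (left_mem_Icc.2 hab) s' hs')
      (hsub hg a (left_mem_Icc.2 hab) s hs)
  have key : ∀ η > 0, ζ b * x b - ζ a * x a - ∫ r in a..b, (U r * x r + ζ r * f r) ≤
      η * ∫ r in a..b, (|U r| + |f r|) := by
    intro η hη
    obtain ⟨δ₁, hδ₁, h₁⟩ := Metric.uniformContinuousOn_iff.1
      (isCompact_Icc.uniformContinuousOn_of_continuous hxc) η hη
    obtain ⟨δ₂, hδ₂, h₂⟩ := Metric.uniformContinuousOn_iff.1
      (isCompact_Icc.uniformContinuousOn_of_continuous hζ) η hη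
    have := sub_le_sub_of_local
      (D := fun s => ζ s * x s - ∫ r in a..s, (U r * x r + ζ r * f r))
      (H := fun s => η * ∫ r in a..s, (|U r| + |f r|)) hab (lt_min hδ₁ hδ₂) ?_
    · simp only [intervalIntegral.integral_same, mul_zero, sub_zero] at this
      linarith
    -- `Δ(ζ x) = x(s') Δζ + ζ(s) Δx`; freezing `x` at `s'` and `ζ` at `s` costs at most `η` times the
    -- integral of `|U| + |f|`, by uniform continuity.
    intro s hs s' hs' hss hlt
    have e1 : x s' - x s = ∫ r in s..s', f r := by
      rw [hx s' hs', hx s hs, ← hdiff hf s hs s' hs']; ring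
    have e2 := hUζ s hs s' hs' hss
    have i1 := hsub hI s hs s' hs'
    have i2 := hsub hV s hs s' hs'
    have iU := hsub hU s hs s' hs'
    have if' := hsub hf s hs s' hs'
    have e3 : x s' * (∫ r in s..s', U r) + ζ s * (∫ r in s..s', f r) -
        (∫ r in s..s', (U r * x r + ζ r * f r)) ≤ η * ∫ r in s..s', (|U r| + |f r|) := by
      rw [← intervalIntegral.integral_const_mul, ← intervalIntegral.integral_const_mul,
        ← intervalIntegral.integral_const_mul,
        ← intervalIntegral.integral_add (iU.const_mul _) (if'.const_mul _),
        ← intervalIntegral.integral_sub ((iU.const_mul _).add (if'.const_mul _)) i1]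
      refine intervalIntegral.integral_mono_on hss
        (((iU.const_mul _).add (if'.const_mul _)).sub i1) (i2.const_mul _) fun r hr => ?_
      have hr' : r ∈ Icc a b := ⟨hs.1.trans hr.1, hr.2.trans hs'.2⟩
      have d1 : |x s' - x r| ≤ η := by
        have := h₁ s' hs' r hr' (by
          rw [Real.dist_eq, abs_of_nonneg (by linarith [hr.2])]
          exact lt_of_le_of_lt (by linarith [hr.1]) (hlt.trans_le (min_le_left _ _)))
        rw [Real.dist_eq] at this; exact this.le
      have d2 : |ζ s - ζ r| ≤ η := by
        have := h₂ s hs r hr' (by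
          rw [Real.dist_eq, abs_sub_comm, abs_of_nonneg (by linarith [hr.1])]
          exact lt_of_le_of_lt (by linarith [hr.2]) (hlt.trans_le (min_le_right _ _)))
        rw [Real.dist_eq] at this; exact this.le
      have e : x s' * U r + ζ s * f r - (U r * x r + ζ r * f r)
          = (x s' - x r) * U r + (ζ s - ζ r) * f r := by ring
      have m1 : (x s' - x r) * U r ≤ η * |U r| :=
        (le_abs_self _).trans (by rw [abs_mul]; gcongr)
      have m2 : (ζ s - ζ r) * f r ≤ η * |f r| :=
        (le_abs_self _).trans (by rw [abs_mul]; gcongr)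
      calc _ = _ := e
        _ ≤ η * |U r| + η * |f r| := add_le_add m1 m2
        _ = _ := by ring
    have e4 := hdiff hI s hs s' hs'
    have e5 := hdiff hV s hs s' hs'
    have e6 : (ζ s' - ζ s) * x s' ≤ x s' * ∫ r in s..s', U r := by
      rw [mul_comm]; exact mul_le_mul_of_nonneg_left e2 (hx0 s' hs')
    simp only [← mul_sub]
    rw [e5]
    refine le_trans (le_of_eq ?_) (le_trans (add_le_add_left e6 (ζ s * (∫ r in s..s', f r) -
        (∫ r in s..s', (U r * x r + ζ r * f r)))) (le_trans (le_of_eq ?_) e3))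
    · rw [← e1, ← e4]; ring
    · ring
  have hH : 0 ≤ ∫ r in a..b, (|U r| + |f r|) :=
    intervalIntegral.integral_nonneg hab fun r _ => by positivity
  have : ζ b * x b - ζ a * x a - ∫ r in a..b, (U r * x r + ζ r * f r) ≤ 0 := by
    refine le_of_forall_pos_le_add fun e he => ?_
    have := key (e / ((∫ r in a..b, (|U r| + |f r|)) + 1)) (by positivity)
    refine this.trans ?_
    rw [zero_add, div_mul_eq_mul_div, div_le_iff₀ (by positivity)]
    nlinarith
  linarith

/-- The timer clamped to `[0, T]`, used to extend functions on `[0, T]` to the real line. -/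
def clamp (T τ : ℝ) : ℝ := max 0 (min T τ)

theorem clamp_mem {T : ℝ} (hT : 0 ≤ T) (τ : ℝ) : clamp T τ ∈ Icc 0 T :=
  ⟨le_max_left _ _, max_le hT (min_le_left _ _)⟩

theorem clamp_eq {T τ : ℝ} (h : τ ∈ Icc 0 T) : clamp T τ = τ := by
  rw [clamp, min_eq_right h.2, max_eq_right h.1]

theorem continuous_comp_clamp {α : Type*} [TopologicalSpace α] {F : ℝ → α} {T : ℝ} (hT : 0 ≤ T)
    (hF : ContinuousOn F (Icc 0 T)) : Continuous fun τ => F (clamp T τ) :=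
  hF.comp_continuous (by unfold clamp; fun_prop) (clamp_mem hT)

/-- A continuous matrix function on `[0, T]` is uniformly bounded as a family of operators. -/
theorem exists_bound_mulVec {m n : ℕ} {F : ℝ → Matrix (Fin m) (Fin n) ℝ} {T : ℝ}
    (hF : ContinuousOn F (Icc 0 T)) :
    ∃ B, 0 ≤ B ∧ ∀ τ ∈ Icc 0 T, ∀ v : Fin n → ℝ, ‖F τ *ᵥ v‖ ≤ B * ‖v‖ := by
  have hc : ContinuousOn (fun τ => ∑ i, ∑ j, |F τ i j|) (Icc 0 T) := by
    refine continuousOn_finsetSum _ fun i _ => continuousOn_finsetSum _ fun j _ => ?_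
    exact ((continuousOn_pi.1 ((continuousOn_pi.1 hF) i)) j).abs
  obtain ⟨B, hB⟩ := isCompact_Icc.exists_bound_of_continuousOn hc
  refine ⟨max B 0, le_max_right _ _, fun τ hτ v => ?_⟩
  have h1 : ∑ i, ∑ j, |F τ i j| ≤ max B 0 :=
    (le_abs_self _).trans ((hB τ hτ).trans (le_max_left _ _))
  refine (pi_norm_le_iff_of_nonneg (by positivity)).2 fun i => ?_
  calc ‖(F τ *ᵥ v) i‖ ≤ ∑ j, ‖F τ i j * v j‖ := by
        simp only [Matrix.mulVec, dotProduct]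
        exact norm_sum_le _ _
    _ ≤ ∑ j, |F τ i j| * ‖v‖ := by
        refine Finset.sum_le_sum fun j _ => ?_
        rw [norm_mul, Real.norm_eq_abs]
        gcongr
        exact norm_le_pi_norm v j
    _ = (∑ j, |F τ i j|) * ‖v‖ := by rw [Finset.sum_mul]
    _ ≤ max B 0 * ‖v‖ := by
        gcongr
        exact (Finset.single_le_sum (f := fun i => ∑ j, |F τ i j|)
          (fun i _ => Finset.sum_nonneg fun j _ => abs_nonneg _) (Finset.mem_univ i)).trans h1

/-! ### Existence of solutions -/

theorem _root_.IntervalIntegrable.of_eval {n : ℕ} {v : ℝ → Fin n → ℝ} {a b : ℝ}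
    (h : ∀ i, IntervalIntegrable (fun r => v r i) volume a b) : IntervalIntegrable v volume a b :=
  ⟨Integrable.of_eval fun i => (h i).1, Integrable.of_eval fun i => (h i).2⟩

theorem _root_.IntervalIntegrable.eval {n : ℕ} {v : ℝ → Fin n → ℝ} {a b : ℝ}
    (h : IntervalIntegrable v volume a b) (i : Fin n) :
    IntervalIntegrable (fun r => v r i) volume a b :=
  ⟨Integrable.eval h.1 i, Integrable.eval h.2 i⟩

theorem _root_.IntervalIntegrable.mulVec {m n : ℕ} {A : ℝ → Matrix (Fin m) (Fin n) ℝ}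
    {v : ℝ → Fin n → ℝ} {a b : ℝ} (hv : IntervalIntegrable v volume a b) (hA : Continuous A) :
    IntervalIntegrable (fun r => A r *ᵥ v r) volume a b := by
  refine .of_eval fun i => ?_
  have : (fun r => (A r *ᵥ v r) i) = ∑ j, fun r => A r i j * v r j := by
    ext r; simp [Matrix.mulVec, dotProduct]
  rw [this]
  refine IntervalIntegrable.sum _ fun j _ => ?_
  exact (hv.eval j).continuousOn_mul
    (((continuous_apply j).comp ((continuous_apply i).comp hA)).continuousOn)

theorem intervalIntegral_eval {n : ℕ} {v : ℝ → Fin n → ℝ} {a b : ℝ}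
    (h : IntervalIntegrable v volume a b) (i : Fin n) :
    (∫ r in a..b, v r) i = ∫ r in a..b, v r i := by
  simp only [intervalIntegral, Pi.sub_apply]
  rw [eval_integral fun i => Integrable.eval h.1 i, eval_integral fun i => Integrable.eval h.2 i]

/-- The map that continues the past `p` beyond time `a` by `exp (L (r - a)) u (r)`. -/
noncomputable def continuation {n : ℕ} {a b : ℝ} (hab : a ≤ b) (L : ℝ) (p : ℝ → Fin n → ℝ)
    (u : C(Icc a b, Fin n → ℝ)) (r : ℝ) : Fin n → ℝ :=
  if r ≤ a then p r else Real.exp (L * (r - a)) • u (projIcc a b hab r)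

theorem intervalIntegrable_continuation {n : ℕ} {a b h : ℝ} (hab : a ≤ b) (hh : 0 < h) (L : ℝ)
    {p : ℝ → Fin n → ℝ} (hp : IntervalIntegrable p volume (a - h) a)
    (u : C(Icc a b, Fin n → ℝ)) :
    IntervalIntegrable (continuation hab L p u) volume (a - h) b := by
  refine IntervalIntegrable.trans (b := a) (hp.congr fun r hr => ?_) ?_
  · rw [uIoc_of_le (by linarith)] at hr
    simp [continuation, hr.2]
  · have : Continuous fun r => Real.exp (L * (r - a)) • u (projIcc a b hab r) := by fun_prop
    refine (this.intervalIntegrable a b).congr fun r hr => ?_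
    rw [uIoc_of_le hab] at hr
    simp [continuation, hr.1]

/-- Carathéodory solutions of a linear delay equation on one interval, by a contraction argument in
the norm weighted with `exp (-L (r - a))`. No lower bound on the delay is needed. -/
theorem exists_delay_flow {n : ℕ} {A G : ℝ → Matrix (Fin n) (Fin n) ℝ} (hA : Continuous A)
    (hG : Continuous G) {K₁ K₂ : ℝ} (hK₁ : 0 ≤ K₁) (hK₂ : 0 ≤ K₂)
    (hAK : ∀ r v, ‖A r *ᵥ v‖ ≤ K₁ * ‖v‖) (hGK : ∀ r v, ‖G r *ᵥ v‖ ≤ K₂ * ‖v‖)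
    {a b h : ℝ} (hab : a ≤ b) (hh : 0 < h) (x₀ : Fin n → ℝ) {p : ℝ → Fin n → ℝ}
    (hp : IntervalIntegrable p volume (a - h) a) {f : ℝ → Fin n → ℝ}
    (hf : IntervalIntegrable f volume a b) :
    ∃ x : ℝ → Fin n → ℝ, (∀ s ≤ a, x s = p s) ∧ IntervalIntegrable x volume a b ∧
      IntervalIntegrable (fun r => A r *ᵥ x r + G r *ᵥ x (r - h) + f r) volume a b ∧
      ∀ s ∈ Ioc a b, x s = x₀ + ∫ r in a..s, (A r *ᵥ x r + G r *ᵥ x (r - h) + f r) := by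
  set L : ℝ := 2 * (K₁ + K₂) + 1 with hL
  have hL0 : 0 < L := by positivity
  set X := continuation hab L p with hX
  set F : C(Icc a b, Fin n → ℝ) → ℝ → Fin n → ℝ :=
    fun u r => A r *ᵥ X u r + G r *ᵥ X u (r - h) + f r with hF
  have hXi : ∀ u, IntervalIntegrable (X u) volume (a - h) b :=
    intervalIntegrable_continuation hab hh L hp
  have hXab : ∀ u, IntervalIntegrable (X u) volume a b := fun u =>
    (hXi u).mono_set (by
      rw [uIcc_of_le hab, uIcc_of_le (by linarith)]; exact Icc_subset_Icc_left (by linarith))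
  have hXd : ∀ u, IntervalIntegrable (fun r => X u (r - h)) volume a b := fun u => by
    have := (hXi u).comp_sub_right h
    refine this.mono_set ?_
    rw [uIcc_of_le hab, uIcc_of_le (by linarith)]
    exact Icc_subset_Icc (by linarith) (by linarith)
  have hFi : ∀ u, IntervalIntegrable (F u) volume a b := fun u =>
    (((hXab u).mulVec hA).add ((hXd u).mulVec hG)).add hf
  have hFs : ∀ u, ∀ s ∈ Icc a b, IntervalIntegrable (F u) volume a s := fun u s hs =>
    (hFi u).mono_set (by
      rw [uIcc_of_le hab, uIcc_of_le hs.1]; exact Icc_subset_Icc_right hs.2)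
  have hcont : ∀ u, ContinuousOn (fun s => ∫ r in a..s, F u r) (Icc a b) := fun u => by
    have := intervalIntegral.continuousOn_primitive_interval' (hFi u) left_mem_uIcc
    rwa [uIcc_of_le hab] at this
  let Φ : C(Icc a b, Fin n → ℝ) → C(Icc a b, Fin n → ℝ) := fun u =>
    ⟨fun s => Real.exp (-(L * (s - a))) • (x₀ + ∫ r in a..s, F u r), by
      have h1 : Continuous fun s : Icc a b => ∫ r in a..(s : ℝ), F u r :=
        continuousOn_iff_continuous_domRestrict.1 (hcont u)
      fun_prop⟩
  have hXdiff : ∀ u v r, ‖X u r - X v r‖ ≤ Real.exp (L * (r - a)) * dist u v := by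
    intro u v r
    simp only [hX, continuation]
    split_ifs
    · simp only [sub_self, norm_zero]; positivity
    · rw [← smul_sub, norm_smul, Real.norm_eq_abs, abs_of_pos (Real.exp_pos _), ← dist_eq_norm]
      gcongr
      exact ContinuousMap.dist_apply_le_dist _
  have hexp : ∀ s, ∫ r in a..s, Real.exp (L * (r - a)) = (Real.exp (L * (s - a)) - 1) / L := by
    intro s
    have hd : ∀ r, HasDerivAt (fun r => Real.exp (L * (r - a)) / L) (Real.exp (L * (r - a))) r := by
      intro r
      have h1 : HasDerivAt (fun r => L * (r - a)) L r := by
        simpa using ((hasDerivAt_id r).sub_const a).const_mul L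
      have := h1.exp.div_const L
      rwa [mul_div_assoc, div_self hL0.ne', mul_one] at this
    rw [intervalIntegral.integral_eq_sub_of_hasDerivAt (fun r _ => hd r)
      (Continuous.intervalIntegrable (by fun_prop) _ _)]
    simp; ring
  have hcontr : ContractingWith (1 / 2) Φ := by
    refine ⟨by rw [← NNReal.coe_lt_coe]; norm_num, LipschitzWith.of_dist_le_mul fun u v => ?_⟩
    refine (ContinuousMap.dist_le (by positivity)).2 fun s => ?_
    have hsub : (x₀ + ∫ r in a..(s : ℝ), F u r) - (x₀ + ∫ r in a..(s : ℝ), F v r)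
        = ∫ r in a..(s : ℝ), (F u r - F v r) := by
      rw [intervalIntegral.integral_sub (hFs u s s.2) (hFs v s s.2)]; abel
    have hbound : ‖∫ r in a..(s : ℝ), (F u r - F v r)‖ ≤
        ∫ r in a..(s : ℝ), (K₁ + K₂) * dist u v * Real.exp (L * (r - a)) := by
      refine intervalIntegral.norm_integral_le_of_norm_le s.2.1 (Eventually.of_forall
        fun r _ => ?_) (Continuous.intervalIntegrable (by fun_prop) _ _)
      have e : F u r - F v r = A r *ᵥ (X u r - X v r) + G r *ᵥ (X u (r - h) - X v (r - h)) := by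
        simp only [hF, Matrix.mulVec_sub]; abel
      rw [e]
      have h1 := (hAK r (X u r - X v r)).trans (mul_le_mul_of_nonneg_left (hXdiff u v r) hK₁)
      have h2 := (hGK r (X u (r - h) - X v (r - h))).trans
        (mul_le_mul_of_nonneg_left (hXdiff u v (r - h)) hK₂)
      have h3 : Real.exp (L * (r - h - a)) ≤ Real.exp (L * (r - a)) := by
        gcongr; linarith
      have h4 : K₂ * (Real.exp (L * (r - h - a)) * dist u v) ≤
          K₂ * (Real.exp (L * (r - a)) * dist u v) := by gcongr
      refine (norm_add_le _ _).trans ?_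
      linarith
    rw [intervalIntegral.integral_const_mul, hexp] at hbound
    show dist (Real.exp (-(L * (s - a))) • (x₀ + ∫ r in a..(s : ℝ), F u r))
      (Real.exp (-(L * (s - a))) • (x₀ + ∫ r in a..(s : ℝ), F v r)) ≤ _
    rw [dist_eq_norm, ← smul_sub, hsub, norm_smul, Real.norm_eq_abs, abs_of_pos (Real.exp_pos _)]
    have hE : Real.exp (-(L * (s - a))) * Real.exp (L * (s - a)) = 1 := by
      rw [← Real.exp_add]; simp
    have hE0 := Real.exp_pos (-(L * ((s : ℝ) - a)))
    have hK : (K₁ + K₂) / L ≤ 1 / 2 := by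
      rw [div_le_iff₀ hL0, hL]; linarith
    calc _ ≤ Real.exp (-(L * (s - a))) *
          ((K₁ + K₂) * dist u v * ((Real.exp (L * (s - a)) - 1) / L)) := by gcongr
      _ = (K₁ + K₂) / L * dist u v * (1 - Real.exp (-(L * (s - a)))) := by
          linear_combination (K₁ + K₂) / L * dist u v * hE
      _ ≤ (K₁ + K₂) / L * dist u v * 1 := by
          gcongr; linarith
      _ ≤ _ := by
          rw [mul_one]
          have : ((1 / 2 : NNReal) : ℝ) = 1 / 2 := by norm_num
          rw [this]
          gcongr
  have : Nonempty C(Icc a b, Fin n → ℝ) := ⟨0⟩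
  set u := ContractingWith.fixedPoint Φ hcontr with hu
  have hfix : Φ u = u := hcontr.fixedPoint_isFixedPt
  refine ⟨X u, fun s hs => by simp [hX, continuation, hs], hXab u, hFi u, fun s hs => ?_⟩
  have hs' : s ∈ Icc a b := Ioc_subset_Icc_self hs
  have h1 : X u s = Real.exp (L * (s - a)) • u ⟨s, hs'⟩ := by
    simp [hX, continuation, not_le.2 hs.1, projIcc_of_mem hab hs']
  have h2 : u ⟨s, hs'⟩ = Real.exp (-(L * (s - a))) • (x₀ + ∫ r in a..s, F u r) := by
    conv_lhs => rw [← hfix]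
    rfl
  rw [h1, h2, smul_smul, ← Real.exp_add]
  simp [hF]

section Dwell

variable {Tmin Tmax : ℝ} {t : ℕ → ℝ}

theorem rangeDwell.strictMono (ht : t ∈ rangeDwell Tmin Tmax) : StrictMono t :=
  strictMono_nat_of_lt_succ fun k => sub_pos.1 (ht.2.1 k)

theorem rangeDwell.nonneg (ht : t ∈ rangeDwell Tmin Tmax) (k : ℕ) : 0 ≤ t k := by
  rw [← ht.1]; exact (rangeDwell.strictMono ht).monotone (Nat.zero_le k)

theorem rangeDwell.lt_succ (ht : t ∈ rangeDwell Tmin Tmax) (k : ℕ) : t k < t (k + 1) :=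
  sub_pos.1 (ht.2.1 k)

theorem rangeDwell.Tmax_pos (ht : t ∈ rangeDwell Tmin Tmax) : 0 < Tmax :=
  (ht.2.1 0).trans_le (ht.2.2.1 0).2

theorem rangeDwell.sub_mem (ht : t ∈ rangeDwell Tmin Tmax) {k : ℕ} {r : ℝ}
    (hr : r ∈ Icc (t k) (t (k + 1))) : r - t k ∈ Icc 0 Tmax :=
  ⟨by linarith [hr.1], by linarith [hr.2, (ht.2.2.1 k).2]⟩

theorem rangeDwell.exists_mem_Ioc (ht : t ∈ rangeDwell Tmin Tmax) {s : ℝ} (hs : 0 < s) :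
    ∃ k, s ∈ Ioc (t k) (t (k + 1)) := by
  classical
  have hex : ∃ k, s ≤ t k := (ht.2.2.2.eventually_ge_atTop s).exists
  have h0 : Nat.find hex ≠ 0 := fun h => by
    have := Nat.find_spec hex
    rw [h, ht.1] at this; linarith
  obtain ⟨k, hk⟩ := Nat.exists_eq_succ_of_ne_zero h0
  refine ⟨k, not_le.1 (Nat.find_min hex (m := k) (by omega)), ?_⟩
  have := Nat.find_spec hex
  rwa [hk] at this

end Dwell

namespace Sys

variable {n pc pd qc qd : ℕ}

/-- The system has a solution for all initial data and all locally integrable inputs. -/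
theorem exists_isSolution (S : Sys n pc pd qc qd) {Tmin Tmax : ℝ}
    (hA : ContinuousOn S.A (Icc 0 Tmax)) (hG : ContinuousOn S.Gc (Icc 0 Tmax))
    (hE : ContinuousOn S.Ec (Icc 0 Tmax)) {t : ℕ → ℝ} (ht : t ∈ rangeDwell Tmin Tmax) {hc : ℝ}
    (hc0 : 0 < hc) (hd : ℕ) {φ : ℝ → Fin n → ℝ} (hφ : ContinuousOn φ (Icc (-hc) 0))
    (ψ : ℕ → Fin n → ℝ) {wc : ℝ → Fin pc → ℝ} (hw : LocallyIntegrableOn wc (Ici 0))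
    (wd : ℕ → Fin pd → ℝ) : ∃ x, S.IsSolution hc hd t φ ψ wc wd x := by
  classical
  have hT := (rangeDwell.Tmax_pos ht).le
  have hmono := (rangeDwell.strictMono ht).monotone
  obtain ⟨K₁, hK₁, hAK⟩ := exists_bound_mulVec hA
  obtain ⟨K₂, hK₂, hGK⟩ := exists_bound_mulVec hG
  have hstep : ∀ k (p : ℝ → Fin n → ℝ), IntervalIntegrable p volume (-hc) (t k) →
      ∃ y : ℝ → Fin n → ℝ, (∀ s ≤ t k, y s = p s) ∧
        IntervalIntegrable y volume (-hc) (t (k + 1)) ∧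
        IntervalIntegrable (S.flow hc t wc y k) volume (t k) (t (k + 1)) ∧
        ∀ s ∈ Ioc (t k) (t (k + 1)),
          y s = S.post hd t ψ wd p k + ∫ r in (t k)..s, S.flow hc t wc y k r := by
    intro k p hp
    have hk := (rangeDwell.lt_succ ht k).le
    have hk0 := rangeDwell.nonneg ht k
    have hwk : IntervalIntegrable wc volume (t k) (t (k + 1)) := by
      rw [intervalIntegrable_iff_integrableOn_Icc_of_le hk]
      exact (hw.mono_set fun r hr => hk0.trans hr.1).integrableOn_isCompact isCompact_Icc
    obtain ⟨y, hy1, hy2, hy3, hy4⟩ := exists_delay_flow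
      (A := fun r => S.A (clamp Tmax (r - t k))) (G := fun r => S.Gc (clamp Tmax (r - t k)))
      ((continuous_comp_clamp hT hA).comp (continuous_sub_right _))
      ((continuous_comp_clamp hT hG).comp (continuous_sub_right _)) hK₁ hK₂
      (fun r v => hAK _ (clamp_mem hT _) v) (fun r v => hGK _ (clamp_mem hT _) v) hk hc0
      (S.post hd t ψ wd p k) (p := p)
      (hp.mono_set (by
        rw [uIcc_of_le (by linarith), uIcc_of_le (by linarith)]
        exact Icc_subset_Icc_left (by linarith)))
      (hwk.mulVec ((continuous_comp_clamp hT hE).comp (continuous_sub_right (t k))))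
    have hfl : ∀ r ∈ Ioc (t k) (t (k + 1)), S.A (clamp Tmax (r - t k)) *ᵥ y r +
        S.Gc (clamp Tmax (r - t k)) *ᵥ y (r - hc) + S.Ec (clamp Tmax (r - t k)) *ᵥ wc r =
        S.flow hc t wc y k r := fun r hr => by
      rw [clamp_eq (rangeDwell.sub_mem ht (Ioc_subset_Icc_self hr))]; rfl
    refine ⟨y, hy1, ?_, ?_, ?_⟩
    · refine (hp.congr fun r hr => ?_).trans hy2
      rw [uIoc_of_le (by linarith)] at hr
      exact (hy1 r hr.2).symm
    · refine hy3.congr fun r hr => ?_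
      rw [uIoc_of_le hk] at hr
      exact hfl r hr
    · intro s hs
      rw [hy4 s hs]
      congr 1
      refine intervalIntegral.integral_congr_ae (Eventually.of_forall fun r hr => ?_)
      rw [uIoc_of_le hs.1.le] at hr
      exact hfl r ⟨hr.1, hr.2.trans hs.2⟩
  choose! step hs1 hs2 hs3 hs4 using hstep
  let X : ℕ → ℝ → Fin n → ℝ := fun k => Nat.rec φ (fun k p => step k p) k
  have hX : ∀ k, X (k + 1) = step k (X k) := fun k => rfl
  have hXi : ∀ k, IntervalIntegrable (X k) volume (-hc) (t k) := by
    intro k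
    induction k with
    | zero =>
      rw [ht.1]
      exact (hφ.mono (by rw [uIcc_of_le (by linarith)])).intervalIntegrable
    | succ k ih => rw [hX]; exact hs2 k _ ih
  have hXstab : ∀ k m s, s ≤ t k → X (k + m) s = X k s := by
    intro k m s hs
    induction m with
    | zero => rfl
    | succ m ih =>
      rw [← add_assoc, hX, hs1 _ _ (hXi _) s (hs.trans (hmono (Nat.le_add_right k m))), ih]
  have hex : ∀ s, ∃ k, s ≤ t k := fun s => (ht.2.2.2.eventually_ge_atTop s).exists
  let x : ℝ → Fin n → ℝ := fun s => X (Nat.find (hex s)) s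
  have hx : ∀ k s, s ≤ t k → x s = X k s := by
    intro k s hs
    obtain ⟨m, hm⟩ := Nat.exists_eq_add_of_le (Nat.find_min' (hex s) hs)
    conv_rhs => rw [hm]
    exact (hXstab _ m s (Nat.find_spec (hex s))).symm
  have hpost : ∀ k, S.post hd t ψ wd (X k) k = S.post hd t ψ wd x k := by
    intro k
    simp only [post, sample]
    rw [hx k (t k) le_rfl, hx k 0 (rangeDwell.nonneg ht k), hx k (t (k - hd)) (hmono (by omega))]
  have hflow : ∀ k, ∀ r ≤ t (k + 1), S.flow hc t wc (X (k + 1)) k r = S.flow hc t wc x k r := by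
    intro k r hr
    simp only [flow]
    rw [hx (k + 1) r hr, hx (k + 1) (r - hc) (by linarith)]
  refine ⟨x, hφ, fun s hs => hx 0 s (by rw [ht.1]; exact hs.2), fun k => ?_, fun k s hs => ?_⟩
  · refine (hs3 k (X k) (hXi k)).congr fun r hr => ?_
    rw [uIoc_of_le (rangeDwell.lt_succ ht k).le] at hr
    exact hflow k r hr.2
  · rw [hx (k + 1) s hs.2, hX, hs4 k (X k) (hXi k) s hs, hpost]
    congr 1
    refine intervalIntegral.integral_congr_ae (Eventually.of_forall fun r hr => ?_)
    rw [uIoc_of_le hs.1.le] at hr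
    exact hflow k r (hr.2.trans hs.2)

/-! ### Elementary properties of solutions -/

variable {S : Sys n pc pd qc qd} {Tmin Tmax hc : ℝ} {hd : ℕ} {t : ℕ → ℝ}
  {φ : ℝ → Fin n → ℝ} {ψ : ℕ → Fin n → ℝ} {wc : ℝ → Fin pc → ℝ} {wd : ℕ → Fin pd → ℝ}
  {x : ℝ → Fin n → ℝ}

theorem flow_sub (S : Sys n pc pd qc qd) (hc : ℝ) (t : ℕ → ℝ) (w₁ w₂ : ℝ → Fin pc → ℝ)
    (x₁ x₂ : ℝ → Fin n → ℝ) (k : ℕ) (s : ℝ) :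
    S.flow hc t (w₁ - w₂) (x₁ - x₂) k s = S.flow hc t w₁ x₁ k s - S.flow hc t w₂ x₂ k s := by
  simp only [flow, Pi.sub_apply, Matrix.mulVec_sub]; abel

theorem sample_sub (t : ℕ → ℝ) (hd : ℕ) (ψ₁ ψ₂ : ℕ → Fin n → ℝ) (x₁ x₂ : ℝ → Fin n → ℝ) (k : ℕ) :
    sample t hd (ψ₁ - ψ₂) (x₁ - x₂) k = sample t hd ψ₁ x₁ k - sample t hd ψ₂ x₂ k := by
  simp only [sample]; split_ifs <;> rfl

theorem post_sub (S : Sys n pc pd qc qd) (hd : ℕ) (t : ℕ → ℝ) (ψ₁ ψ₂ : ℕ → Fin n → ℝ)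
    (w₁ w₂ : ℕ → Fin pd → ℝ) (x₁ x₂ : ℝ → Fin n → ℝ) (k : ℕ) :
    S.post hd t (ψ₁ - ψ₂) (w₁ - w₂) (x₁ - x₂) k =
      S.post hd t ψ₁ w₁ x₁ k - S.post hd t ψ₂ w₂ x₂ k := by
  simp only [post, sample_sub]
  split_ifs
  · rfl
  · simp only [Pi.sub_apply, Matrix.mulVec_sub]; abel

theorem zc_sub (S : Sys n pc pd qc qd) (hc : ℝ) (w₁ w₂ : ℝ → Fin pc → ℝ)
    (x₁ x₂ : ℝ → Fin n → ℝ) (s : ℝ) :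
    S.zc hc (w₁ - w₂) (x₁ - x₂) s = S.zc hc w₁ x₁ s - S.zc hc w₂ x₂ s := by
  simp only [zc, Pi.sub_apply, Matrix.mulVec_sub]; abel

theorem zd_sub (S : Sys n pc pd qc qd) (hd : ℕ) (t : ℕ → ℝ) (ψ₁ ψ₂ : ℕ → Fin n → ℝ)
    (w₁ w₂ : ℕ → Fin pd → ℝ) (x₁ x₂ : ℝ → Fin n → ℝ) (k : ℕ) :
    S.zd hd t (ψ₁ - ψ₂) (w₁ - w₂) (x₁ - x₂) k =
      S.zd hd t ψ₁ w₁ x₁ k - S.zd hd t ψ₂ w₂ x₂ k := by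
  simp only [zd, sample_sub, Pi.sub_apply, Matrix.mulVec_sub]; abel

theorem IsSolution.sub {φ₂ : ℝ → Fin n → ℝ} {ψ₂ : ℕ → Fin n → ℝ} {wc₂ : ℝ → Fin pc → ℝ}
    {wd₂ : ℕ → Fin pd → ℝ} {x₂ : ℝ → Fin n → ℝ} (ht : t ∈ rangeDwell Tmin Tmax)
    (h : S.IsSolution hc hd t φ ψ wc wd x) (h₂ : S.IsSolution hc hd t φ₂ ψ₂ wc₂ wd₂ x₂) :
    S.IsSolution hc hd t (φ - φ₂) (ψ - ψ₂) (wc - wc₂) (wd - wd₂) (x - x₂) where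
  phi_cont := h.phi_cont.sub h₂.phi_cont
  init s hs := by simp only [Pi.sub_apply, h.init s hs, h₂.init s hs]
  flow_integrable k := by
    have : S.flow hc t (wc - wc₂) (x - x₂) k = S.flow hc t wc x k - S.flow hc t wc₂ x₂ k := by
      ext1 s; exact flow_sub ..
    rw [this]
    exact (h.flow_integrable k).sub (h₂.flow_integrable k)
  flow_eq k s hs := by
    have hsub : uIcc (t k) s ⊆ uIcc (t k) (t (k + 1)) := by
      rw [uIcc_of_le hs.1.le, uIcc_of_le (rangeDwell.lt_succ ht k).le]
      exact Icc_subset_Icc_right hs.2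
    simp only [flow_sub, post_sub]
    rw [intervalIntegral.integral_sub ((h.flow_integrable k).mono_set hsub)
      ((h₂.flow_integrable k).mono_set hsub), Pi.sub_apply, h.flow_eq k s hs, h₂.flow_eq k s hs]
    abel

/-- The continuous representative of the state on `[t k, t (k + 1)]`, equal to `x (t k⁺)` at the
left endpoint. -/
noncomputable def arc (S : Sys n pc pd qc qd) (hc : ℝ) (hd : ℕ) (t : ℕ → ℝ) (ψ : ℕ → Fin n → ℝ)
    (wc : ℝ → Fin pc → ℝ) (wd : ℕ → Fin pd → ℝ) (x : ℝ → Fin n → ℝ) (k : ℕ) (s : ℝ) : Fin n → ℝ :=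
  S.post hd t ψ wd x k + ∫ r in (t k)..s, S.flow hc t wc x k r

theorem arc_left (k : ℕ) : S.arc hc hd t ψ wc wd x k (t k) = S.post hd t ψ wd x k := by
  simp [arc]

theorem IsSolution.arc_eq (h : S.IsSolution hc hd t φ ψ wc wd x) {k : ℕ} {s : ℝ}
    (hs : s ∈ Ioc (t k) (t (k + 1))) : S.arc hc hd t ψ wc wd x k s = x s :=
  (h.flow_eq k s hs).symm

theorem IsSolution.continuousOn_arc (h : S.IsSolution hc hd t φ ψ wc wd x)
    (ht : t ∈ rangeDwell Tmin Tmax) (k : ℕ) :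
    ContinuousOn (S.arc hc hd t ψ wc wd x k) (Icc (t k) (t (k + 1))) := by
  have := intervalIntegral.continuousOn_primitive_interval' (h.flow_integrable k) left_mem_uIcc
  rw [uIcc_of_le (rangeDwell.lt_succ ht k).le] at this
  exact continuousOn_const.add this

theorem IsSolution.intervalIntegrable_Icc (h : S.IsSolution hc hd t φ ψ wc wd x)
    (ht : t ∈ rangeDwell Tmin Tmax) (k : ℕ) : IntervalIntegrable x volume (t k) (t (k + 1)) := by
  have hk := (rangeDwell.lt_succ ht k).le
  refine (ContinuousOn.intervalIntegrable ?_).congr (f := S.arc hc hd t ψ wc wd x k) fun r hr => ?_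
  · rw [uIcc_of_le hk]; exact h.continuousOn_arc ht k
  · rw [uIoc_of_le hk] at hr; exact h.arc_eq hr

theorem IsSolution.intervalIntegrable_past (h : S.IsSolution hc hd t φ ψ wc wd x) (hc0 : 0 < hc) :
    IntervalIntegrable x volume (-hc) 0 := by
  refine (ContinuousOn.intervalIntegrable ?_).congr (f := φ) fun r hr => ?_
  · rw [uIcc_of_le (by linarith)]; exact h.phi_cont
  · rw [uIoc_of_le (by linarith)] at hr; exact (h.init r (Ioc_subset_Icc_self hr)).symm

theorem IsSolution.intervalIntegrable (h : S.IsSolution hc hd t φ ψ wc wd x) (hc0 : 0 < hc)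
    (ht : t ∈ rangeDwell Tmin Tmax) {a b : ℝ} (ha : -hc ≤ a) (hab : a ≤ b) :
    IntervalIntegrable x volume a b := by
  have hk : ∀ k, IntervalIntegrable x volume (-hc) (t k) := by
    intro k
    induction k with
    | zero => rw [ht.1]; exact h.intervalIntegrable_past hc0
    | succ k ih => exact ih.trans (h.intervalIntegrable_Icc ht k)
  obtain ⟨k, hk'⟩ := (ht.2.2.2.eventually_ge_atTop b).exists
  refine (hk k).mono_set ?_
  rw [uIcc_of_le hab, uIcc_of_le (by linarith)]
  exact Icc_subset_Icc ha hk'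

theorem IsSolution.intervalIntegrable_delay (h : S.IsSolution hc hd t φ ψ wc wd x) (hc0 : 0 < hc)
    (ht : t ∈ rangeDwell Tmin Tmax) {a b : ℝ} (ha : 0 ≤ a) (hab : a ≤ b) :
    IntervalIntegrable (fun r => x (r - hc)) volume a b := by
  have := (h.intervalIntegrable hc0 ht (a := a - hc) (b := b - hc) (by linarith)
    (by linarith)).comp_sub_right hc
  simpa using this

/-- Limits from the right at the impulse times inherit nonnegativity. -/
theorem IsSolution.post_nonneg (h : S.IsSolution hc hd t φ ψ wc wd x)
    (ht : t ∈ rangeDwell Tmin Tmax) (hx : ∀ s, 0 ≤ s → 0 ≤ x s) (k : ℕ) :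
    0 ≤ S.post hd t ψ wd x k := by
  have hk := rangeDwell.lt_succ ht k
  have h1 := (h.continuousOn_arc ht k (t k) (left_mem_Icc.2 hk.le)).mono Ioc_subset_Icc_self
  have : (𝓝[Ioc (t k) (t (k + 1))] (t k)).NeBot := by
    rw [nhdsWithin_Ioc_eq_nhdsGT hk]; infer_instance
  rw [← arc_left (S := S) (hc := hc) (wc := wc)]
  refine ge_of_tendsto h1 (eventually_mem_nhdsWithin.mono fun s hs => ?_)
  rw [h.arc_eq hs]
  exact hx s ((rangeDwell.nonneg ht k).trans hs.1.le)

end Sys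

/-! ### Nonnegativity of the matrices acting on delayed states -/

namespace Sys

variable {n pc pd qc qd : ℕ} {S : Sys n pc pd qc qd} {Tmin Tmax : ℝ}

/-- A solution that starts at zero and whose delay exceeds the first dwell-time is controlled on the
first interval by the initial function. -/
theorem IsSolution.norm_arc_zero_le {t : ℕ → ℝ} {hc : ℝ} {hd : ℕ} {φ : ℝ → Fin n → ℝ}
    {ψ : ℕ → Fin n → ℝ} {wd : ℕ → Fin pd → ℝ} {x : ℝ → Fin n → ℝ}
    (h : S.IsSolution hc hd t φ ψ (fun _ => 0) wd x) (ht : t ∈ rangeDwell Tmin Tmax)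
    (hhc : Tmax < hc) {K₁ K₂ : ℝ} (hK₁ : 0 ≤ K₁)
    (hA : ∀ τ ∈ Icc 0 Tmax, ∀ v, ‖S.A τ *ᵥ v‖ ≤ K₁ * ‖v‖)
    (hG : ∀ τ ∈ Icc 0 Tmax, ∀ v, ‖S.Gc τ *ᵥ v‖ ≤ K₂ * ‖v‖) (hφ0 : φ 0 = 0) {s : ℝ}
    (hs : s ∈ Icc 0 (t 1)) :
    ‖S.arc hc hd t ψ (fun _ => 0) wd x 0 s‖ ≤
      (∫ r in (0:ℝ)..s, K₂ * ‖φ (r - hc)‖) * Real.exp (K₁ * s) := by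
  have hT := rangeDwell.Tmax_pos ht
  have ht1 : t 1 ≤ Tmax := by
    have := (ht.2.2.1 0).2
    rw [ht.1] at this; simpa using this
  set y := S.arc hc hd t ψ (fun _ => 0) wd x 0 with hy
  have hyc : ContinuousOn y (Icc 0 (t 1)) := by
    have := h.continuousOn_arc ht 0
    rwa [ht.1] at this
  have hφi : ∀ b ∈ Icc 0 (t 1), IntervalIntegrable (fun r => K₂ * ‖φ (r - hc)‖) volume 0 b := by
    intro b hb
    refine ContinuousOn.intervalIntegrable ?_
    rw [uIcc_of_le hb.1]
    refine continuousOn_const.mul (ContinuousOn.norm (h.phi_cont.comp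
      (continuousOn_id.sub continuousOn_const) fun r hr => ⟨?_, ?_⟩))
    · have := hr.1
      change -hc ≤ r - hc
      linarith
    · have := hr.2.trans (hb.2.trans ht1)
      change r - hc ≤ 0
      linarith
  have hpost : S.post hd t ψ wd x 0 = 0 := by
    simp only [post, if_true]
    rw [h.init 0 ⟨by linarith, le_rfl⟩, hφ0]
  have hmain := le_mul_exp_of_le_integral (q := fun r => ‖y r‖) (a := 0) (b := s) (K := K₁)
    (c := ∫ r in (0:ℝ)..s, K₂ * ‖φ (r - hc)‖) hK₁ (hyc.norm.mono (Icc_subset_Icc_right hs.2)) ?_ s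
    ⟨hs.1, le_rfl⟩
  · simpa using hmain
  intro b hb
  have hb1 : b ∈ Icc 0 (t 1) := ⟨hb.1, hb.2.trans hs.2⟩
  have hyi : IntervalIntegrable (fun r => K₁ * ‖y r‖) volume 0 b := by
    refine ContinuousOn.intervalIntegrable ?_
    rw [uIcc_of_le hb.1]
    exact continuousOn_const.mul (hyc.norm.mono (Icc_subset_Icc_right hb1.2))
  have e1 : ‖y b‖ ≤ ∫ r in (0:ℝ)..b, (K₁ * ‖y r‖ + K₂ * ‖φ (r - hc)‖) := by
    have : y b = ∫ r in (0:ℝ)..b, S.flow hc t (fun _ => 0) x 0 r := by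
      rw [hy, arc, hpost, ht.1, zero_add]
    rw [this]
    refine intervalIntegral.norm_integral_le_of_norm_le hb.1 (Eventually.of_forall fun r hr => ?_)
      (hyi.add (hφi b hb1))
    have hr1 : r ∈ Ioc (t 0) (t 1) := by rw [ht.1]; exact ⟨hr.1, hr.2.trans hb1.2⟩
    have hmem : r - t 0 ∈ Icc 0 Tmax := rangeDwell.sub_mem ht (Ioc_subset_Icc_self hr1)
    have hxr : x r = y r := (h.arc_eq hr1).symm
    have hxd : x (r - hc) = φ (r - hc) :=
      h.init _ ⟨by linarith [hr.1], by linarith [hr.2, hb1.2]⟩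
    simp only [flow, Matrix.mulVec_zero, add_zero, hxr, hxd]
    exact (norm_add_le _ _).trans (add_le_add (hA _ hmem _) (hG _ hmem _))
  rw [intervalIntegral.integral_add hyi (hφi b hb1), intervalIntegral.integral_const_mul] at e1
  have e2 : (∫ r in (0:ℝ)..b, K₂ * ‖φ (r - hc)‖) ≤ ∫ r in (0:ℝ)..s, K₂ * ‖φ (r - hc)‖ := by
    refine intervalIntegral.integral_mono_interval le_rfl hb.1 hb.2 ?_ (hφi s hs)
    refine (ae_restrict_mem measurableSet_Ioc).mono fun r hr => ?_
    have := (norm_nonneg _).trans (hG 0 ⟨le_rfl, hT.le⟩ (φ (r - hc)))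
    exact this
  linarith

variable (hA : ContinuousOn S.A (Icc 0 Tmax)) (hG : ContinuousOn S.Gc (Icc 0 Tmax))
  (hE : ContinuousOn S.Ec (Icc 0 Tmax)) (hpos : S.InternallyPositive (rangeDwell Tmin Tmax))

include hA hG hE hpos

/-- With `hd = 2`, zero initial function and `ψ 1 = eᵢ`, the state vanishes up to the first impulse,
so that `x (t₁⁺)` and `z_d 1` are the `i`-th columns of `Gd` and `Hd`. -/
theorem InternallyPositive.Gd_Hd_nonneg {t : ℕ → ℝ} (ht : t ∈ rangeDwell Tmin Tmax) :
    (∀ j i, 0 ≤ S.Gd j i) ∧ ∀ j i, 0 ≤ S.Hd j i := by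
  obtain ⟨K₁, hK₁, hAK⟩ := exists_bound_mulVec hA
  obtain ⟨K₂, hK₂, hGK⟩ := exists_bound_mulVec hG
  have hT := rangeDwell.Tmax_pos ht
  have main : ∀ i, 0 ≤ S.Gd *ᵥ Pi.single i 1 ∧ 0 ≤ S.Hd *ᵥ Pi.single i 1 := by
    intro i
    obtain ⟨x, hx⟩ := S.exists_isSolution hA hG hE ht (hc := Tmax + 1) (by linarith) 2
      (φ := fun _ => 0) continuousOn_const (fun _ => Pi.single i 1) (wc := fun _ => 0)
      ((locallyIntegrable_const (0 : Fin pc → ℝ)).locallyIntegrableOn _) (fun _ => 0)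
    obtain ⟨h1, -, h3⟩ := hpos (Tmax + 1) (by linarith) 2 t ht _ _ _ _ x hx
      ((locallyIntegrable_const (0 : Fin pc → ℝ)).locallyIntegrableOn _) (fun _ _ => le_rfl)
      (fun _ => Pi.single_nonneg.2 zero_le_one) (fun _ _ => le_rfl) (fun _ _ => le_rfl)
    have hx1 : x (t 1) = 0 := by
      have hb := hx.norm_arc_zero_le ht (by linarith) hK₁ hAK hGK rfl (s := t 1)
        ⟨rangeDwell.nonneg ht 1, le_rfl⟩
      rw [hx.arc_eq ⟨rangeDwell.lt_succ ht 0, le_rfl⟩] at hb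
      simpa using hb
    have hp := hx.post_nonneg ht h1 1
    have hz := h3 1 le_rfl
    simp only [post, zd, sample, hx1] at hp hz
    norm_num at hp hz
    exact ⟨by simpa using hp, by simpa using hz⟩
  refine ⟨fun j i => ?_, fun j i => ?_⟩
  · simpa using (main i).1 j
  · simpa using (main i).2 j

/-- If `Gc τ j i < 0`, then an initial function `q eᵢ` with `q` a bump that is seen through the delay
for the first time near `τ` drives the `j`-th component of the state, so far zero, below zero. -/
theorem InternallyPositive.Gc_nonneg (hT : 0 < Tmax) (hTm : Tmin ≤ Tmax) {τ : ℝ}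
    (hτ : τ ∈ Icc 0 Tmax) (j i : Fin n) : 0 ≤ S.Gc τ j i := by
  by_contra! hneg
  obtain ⟨K₁, hK₁, hAK⟩ := exists_bound_mulVec hA
  obtain ⟨K₂, hK₂, hGK⟩ := exists_bound_mulVec hG
  set t : ℕ → ℝ := fun k => k * Tmax with ht'
  have ht : t ∈ rangeDwell Tmin Tmax := by
    have e : ∀ k, t (k + 1) - t k = Tmax := fun k => by simp only [ht']; push_cast; ring
    refine ⟨by simp [ht'], fun k => by rw [e]; exact hT, fun k => by rw [e]; exact ⟨hTm, le_rfl⟩, ?_⟩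
    exact tendsto_natCast_atTop_atTop.atTop_mul_const hT
  have ht1 : t 1 = Tmax := by simp [ht']
  set c : ℝ := -S.Gc τ j i / 2 with hc
  have hc0 : 0 < c := by simp only [hc]; linarith
  have hGji : ContinuousOn (fun r => S.Gc r j i) (Icc 0 Tmax) :=
    continuousOn_pi.1 (continuousOn_pi.1 hG j) i
  obtain ⟨δ, hδ, hδG⟩ := Metric.continuousWithinAt_iff.1 (hGji τ hτ) c hc0
  set M : ℝ := K₁ * (K₂ * Real.exp (K₁ * Tmax)) with hM
  have hM0 : 0 ≤ M := by positivity
  -- The width of the bump: on an interval of length `d` the entry stays below `-c`, and the response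
  -- through `A`, of order `M d`, cannot compensate for `-c`.
  set d : ℝ := min (min (δ / 2) Tmax) (c / (2 * (M + 1))) with hd
  have hd0 : 0 < d := by positivity
  have hdδ : d < δ := ((min_le_left _ _).trans (min_le_left _ _)).trans_lt (by linarith)
  have hdT : d ≤ Tmax := (min_le_left _ _).trans (min_le_right _ _)
  have hdM : M * d < c := by
    have h1 : d ≤ c / (2 * (M + 1)) := min_le_right _ _
    rw [le_div_iff₀ (by positivity)] at h1
    nlinarith
  set τ₀ : ℝ := min τ (Tmax - d) with hτ₀
  have h0 : 0 ≤ τ₀ := le_min hτ.1 (by linarith)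
  have h1 : τ₀ + d ≤ Tmax := by linarith [min_le_right τ (Tmax - d)]
  have hGc : ∀ r ∈ Icc τ₀ (τ₀ + d), S.Gc r j i ≤ -c := by
    intro r hr
    have hr' : r ∈ Icc 0 Tmax := ⟨h0.trans hr.1, hr.2.trans h1⟩
    have hdist : dist r τ < δ := by
      rw [Real.dist_eq, abs_lt]
      rcases min_cases τ (Tmax - d) with ⟨e, e'⟩ | ⟨e, e'⟩ <;> rw [← hτ₀] at e <;>
        constructor <;> linarith [hr.1, hr.2, hτ.2]
    have := hδG hr' hdist
    rw [Real.dist_eq, abs_lt] at this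
    linarith [this.2]
  set hcd : ℝ := Tmax + 1 with hhcd
  set p : ℝ → ℝ := fun r => max 0 ((r - τ₀) * (τ₀ + d - r)) with hp
  have hpc : Continuous p := by fun_prop
  have hp0 : ∀ r, 0 ≤ p r := fun r => le_max_left _ _
  have hpz : ∀ r, r ≤ τ₀ → p r = 0 := fun r hr =>
    max_eq_left (mul_nonpos_of_nonpos_of_nonneg (by linarith) (by linarith))
  set e : Fin n → ℝ := Pi.single i 1 with he
  have he0 : 0 ≤ e := Pi.single_nonneg.2 zero_le_one
  have hen : ‖e‖ = 1 := by rw [he, Pi.norm_single]; simp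
  obtain ⟨x, hx⟩ := S.exists_isSolution hA hG hE ht (hc := hcd) (by linarith) 0
    (φ := fun s => p (s + hcd) • e) (Continuous.continuousOn (by fun_prop)) (fun _ => 0)
    (wc := fun _ => 0) ((locallyIntegrable_const (0 : Fin pc → ℝ)).locallyIntegrableOn _) (fun _ => 0)
  obtain ⟨hx0, -, -⟩ := hpos hcd (by linarith) 0 t ht _ _ _ _ x hx
    ((locallyIntegrable_const (0 : Fin pc → ℝ)).locallyIntegrableOn _) (fun _ _ => smul_nonneg (hp0 _) he0)
    (fun _ => le_rfl) (fun _ _ => le_rfl) (fun _ _ => le_rfl)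
  set y := S.arc hcd 0 t (fun _ => 0) (fun _ => 0) (fun _ => 0) x 0 with hy
  set P : ℝ → ℝ := fun s => ∫ r in (0:ℝ)..s, p r with hP
  have hpi : ∀ a b, IntervalIntegrable p volume a b := fun a b => hpc.intervalIntegrable a b
  have hyb : ∀ s ∈ Icc 0 Tmax, ‖y s‖ ≤ K₂ * P s * Real.exp (K₁ * Tmax) := by
    intro s hs
    have hb := hx.norm_arc_zero_le ht (by linarith) hK₁ hAK hGK (by
      have : p (0 + hcd) = 0 :=
        max_eq_left (mul_nonpos_of_nonneg_of_nonpos (by linarith) (by linarith))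
      rw [this, zero_smul]) (s := s) (by rwa [ht1])
    have hPn : 0 ≤ P s := intervalIntegral.integral_nonneg hs.1 fun r _ => hp0 r
    simp only [sub_add_cancel, norm_smul, hen, mul_one, Real.norm_eq_abs,
      abs_of_nonneg (hp0 _), intervalIntegral.integral_const_mul] at hb
    refine hb.trans ?_
    gcongr
    exact hs.2
  have hPτ : P τ₀ = 0 := by
    simp only [hP]
    rw [intervalIntegral.integral_congr (g := fun _ => 0) fun r hr => ?_]
    · simp
    · rw [uIcc_of_le h0] at hr; exact hpz r hr.2
  have hyτ : y τ₀ = 0 := by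
    have := hyb τ₀ ⟨h0, by linarith⟩
    rw [hPτ] at this
    simpa using this
  -- From `τ₀` to `τ₀ + d` the `j`-th component changes by at most `(M d - c) Q < 0`.
  set Q := ∫ r in τ₀..(τ₀ + d), p r with hQ
  have hQ0 : 0 < Q := by
    refine intervalIntegral.intervalIntegral_pos_of_pos_on (hpi _ _) (fun r hr => ?_) (by linarith)
    exact lt_max_of_lt_right (mul_pos (by linarith [hr.1]) (by linarith [hr.2]))
  have hPQ : ∀ r ∈ Icc τ₀ (τ₀ + d), P r ≤ Q := by
    intro r hr
    have : P r = P τ₀ + ∫ r in τ₀..r, p r :=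
      (intervalIntegral.integral_add_adjacent_intervals (hpi _ _) (hpi _ _)).symm
    rw [this, hPτ, zero_add]
    exact intervalIntegral.integral_mono_interval le_rfl hr.1 hr.2
      (Eventually.of_forall fun r => hp0 r) (hpi _ _)
  have hfi := hx.flow_integrable 0
  rw [ht.1, zero_add, ht1] at hfi
  have hsub : ∀ a ∈ Icc 0 Tmax, ∀ b ∈ Icc 0 Tmax,
      IntervalIntegrable (S.flow hcd t (fun _ => 0) x 0) volume a b := fun a ha b hb =>
    hfi.mono_set (by rw [uIcc_of_le hT.le]; exact uIcc_subset_Icc ha hb)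
  have hm0 : τ₀ ∈ Icc 0 Tmax := ⟨h0, by linarith⟩
  have hm1 : τ₀ + d ∈ Icc 0 Tmax := ⟨by linarith, h1⟩
  have hinc : y (τ₀ + d) = ∫ r in τ₀..(τ₀ + d), S.flow hcd t (fun _ => 0) x 0 r := by
    have : y (τ₀ + d) = y τ₀ + ∫ r in τ₀..(τ₀ + d), S.flow hcd t (fun _ => 0) x 0 r := by
      simp only [hy, arc]
      rw [ht.1, add_assoc, intervalIntegral.integral_add_adjacent_intervals
        (hsub 0 ⟨le_rfl, hT.le⟩ _ hm0) (hsub _ hm0 _ hm1)]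
    rw [this, hyτ, zero_add]
  have hle : y (τ₀ + d) j ≤ ∫ r in τ₀..(τ₀ + d), (M * Q - c * p r) := by
    rw [hinc, intervalIntegral_eval (hsub _ hm0 _ hm1)]
    refine intervalIntegral.integral_mono_on_of_le_Ioo (by linarith)
      ((hsub _ hm0 _ hm1).eval j)
      (Continuous.intervalIntegrable (by fun_prop) _ _) fun r hr => ?_
    have hrI : r ∈ Icc τ₀ (τ₀ + d) := Ioo_subset_Icc_self hr
    have hr0 : r ∈ Icc 0 Tmax := ⟨h0.trans hrI.1, hrI.2.trans h1⟩
    have hrt : r ∈ Ioc (t 0) (t 1) := by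
      rw [ht.1, ht1]; exact ⟨h0.trans_lt hr.1, hr0.2⟩
    have hxr : x r = y r := (hx.arc_eq hrt).symm
    have hxd : x (r - hcd) = p r • e := by
      rw [hx.init _ ⟨by linarith [hr0.1], by linarith [hr0.2]⟩, sub_add_cancel]
    simp only [flow, Matrix.mulVec_zero, hxr, hxd, ht.1, sub_zero, Pi.add_apply, Pi.zero_apply]
    have b1 : (S.A r *ᵥ y r) j ≤ M * Q := by
      calc (S.A r *ᵥ y r) j ≤ ‖S.A r *ᵥ y r‖ := (le_abs_self _).trans (norm_le_pi_norm (S.A r *ᵥ y r) j)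
        _ ≤ K₁ * ‖y r‖ := hAK r hr0 _
        _ ≤ K₁ * (K₂ * Q * Real.exp (K₁ * Tmax)) := by
            gcongr
            refine (hyb r hr0).trans ?_
            gcongr
            exact hPQ r hrI
        _ = M * Q := by simp only [hM]; ring
    have b2 : (S.Gc r *ᵥ (p r • e)) j ≤ -(c * p r) := by
      rw [Matrix.mulVec_smul, he, Matrix.mulVec_single_one, Pi.smul_apply, smul_eq_mul]
      have := mul_le_mul_of_nonneg_left (hGc r hrI) (hp0 r)
      simp only [Matrix.col_apply]
      linarith
    linarith
  rw [intervalIntegral.integral_sub (by simp) ((hpi _ _).const_mul c),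
    intervalIntegral.integral_const, intervalIntegral.integral_const_mul] at hle
  have hyx : y (τ₀ + d) = x (τ₀ + d) := hx.arc_eq (by
    rw [ht.1, ht1]; exact ⟨by linarith, h1⟩)
  have hnn := hx0 (τ₀ + d) hm1.1 j
  rw [← hyx] at hnn
  simp only [Pi.zero_apply, smul_eq_mul, add_sub_cancel_left] at hnn hle
  have : d * (M * Q) - c * Q < 0 := by nlinarith
  linarith

end Sys

/-! ### Delay-invariant multipliers -/

theorem timer_eq {Tmin Tmax : ℝ} {t : ℕ → ℝ} (ht : t ∈ rangeDwell Tmin Tmax) {k : ℕ} {s : ℝ}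
    (hs : s ∈ Ioc (t k) (t (k + 1))) : timer t s = s - t k := by
  have : IsGreatest {r | ∃ k, r = t k ∧ r < s} (t k) := by
    refine ⟨⟨k, rfl, hs.1⟩, ?_⟩
    rintro _ ⟨m, rfl, hm⟩
    refine (rangeDwell.strictMono ht).monotone (not_lt.1 fun hkm => ?_)
    exact absurd (hm.trans_le hs.2)
      (not_lt.2 ((rangeDwell.strictMono ht).monotone (Nat.succ_le_of_lt hkm)))
  rw [timer, this.csSup_eq]

theorem timer_mem {Tmin Tmax : ℝ} {t : ℕ → ℝ} (ht : t ∈ rangeDwell Tmin Tmax) {s : ℝ}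
    (hs : 0 < s) : timer t s ∈ Icc 0 Tmax := by
  obtain ⟨k, hk⟩ := rangeDwell.exists_mem_Ioc ht hs
  rw [timer_eq ht hk]
  exact rangeDwell.sub_mem ht (Ioc_subset_Icc_self hk)

theorem measurable_timer {Tmin Tmax : ℝ} {t : ℕ → ℝ} (ht : t ∈ rangeDwell Tmin Tmax) :
    Measurable (timer t) := by
  have hbdd : ∀ s, BddAbove {r | ∃ k, r = t k ∧ r < s} := fun s => ⟨s, by
    rintro _ ⟨m, rfl, hm⟩; exact hm.le⟩
  have hmono : Monotone fun s => sSup {r | ∃ k, r = t k ∧ r < s} := by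
    intro s s' hss
    rcases le_or_gt s 0 with hs | hs
    · have hempty : {r | ∃ k, r = t k ∧ r < s} = ∅ := by
        ext r
        simp only [mem_ofPred_eq, mem_empty_iff_false, iff_false]
        rintro ⟨k, rfl, hk⟩
        linarith [rangeDwell.nonneg ht k]
      simp only [hempty, Real.sSup_empty]
      refine Real.sSup_nonneg ?_
      rintro _ ⟨k, rfl, -⟩
      exact rangeDwell.nonneg ht k
    · refine csSup_le_csSup (hbdd s') ⟨t 0, 0, rfl, by rwa [ht.1]⟩ ?_
      rintro _ ⟨k, rfl, hk⟩
      exact ⟨k, rfl, hk.trans_le hss⟩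
  exact measurable_id.sub hmono.measurable

/-- Commutation with the delay operator, tested on the signal with all components `exp (-s)`. -/
theorem timerScalings.ae_eq {n : ℕ} {Tmax h : ℝ} {t : ℕ → ℝ} {μ : ℝ → Fin n → ℝ} (hh : 0 < h)
    (hμ : μ ∈ timerScalings n Tmax h t) :
    ∀ᵐ s, h < s → μ (timer t s) = μ (timer t (s - h)) := by
  have hz : IntegrableOn (fun (s : ℝ) (_ : Fin n) => Real.exp (-s)) (Ioi 0) :=
    Integrable.of_eval fun i => integrableOn_exp_neg_Ioi 0
  have := (ae_restrict_iff' measurableSet_Ioi).1 (hμ.2 _ hz)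
  filter_upwards [this] with s hs hlt
  have h1 := hs (mem_Ioi.2 (hh.trans hlt))
  simp only [delayOp, if_pos hlt] at h1
  ext i
  have h2 := congrFun h1 i
  simp only [Matrix.mulVec_diagonal] at h2
  exact mul_right_cancel₀ (Real.exp_pos _).ne' h2

/-- A scaling that commutes with the delay operator need not be measurable or bounded. It can be
replaced by a bounded measurable multiplier, invariant under the delay, that lies between a given
bounded measurable minorant `ℓ` and the scaling: the supremum of `ℓ` over all translates by multiples
of the delay, set to zero on a null set. -/
theorem timerScalings.exists_multiplier {n : ℕ} {Tmin Tmax h : ℝ} {t : ℕ → ℝ} {μ : ℝ → Fin n → ℝ}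
    (hh : 0 < h) (ht : t ∈ rangeDwell Tmin Tmax) (hμ : μ ∈ timerScalings n Tmax h t)
    {ℓ : ℝ → Fin n → ℝ} (hℓm : Measurable ℓ) {B : ℝ} (hℓ0 : ∀ τ i, 0 ≤ ℓ τ i)
    (hℓB : ∀ τ i, ℓ τ i ≤ B) (hℓμ : ∀ τ ∈ Icc 0 Tmax, ∀ i, ℓ τ i ≤ μ τ i) :
    ∃ M : ℝ → Fin n → ℝ, Measurable M ∧ (∀ s i, 0 ≤ M s i) ∧ (∀ s i, M s i ≤ B) ∧
      (∀ s, 0 < s → ∀ i, M s i ≤ μ (timer t s) i) ∧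
      (∀ᵐ s, 0 < s → ∀ i, ℓ (timer t s) i ≤ M s i) ∧ ∀ᵐ s, M (s + h) = M s := by
  classical
  set P : ℝ → Prop := fun s => h < s → μ (timer t s) = μ (timer t (s - h)) with hP
  have hPae : ∀ᵐ s, P s := timerScalings.ae_eq hh hμ
  have hPall : ∀ᵐ s, ∀ k : ℤ, P (s + k * h) := ae_all_iff.2 fun k =>
    (measurePreserving_add_right volume ((k : ℝ) * h)).quasiMeasurePreserving.ae hPae
  -- Outside the null set `N` the scaling is constant along the whole orbit of a time under translation
  -- by the delay.
  set N := toMeasurable volume {s | ¬ ∀ k : ℤ, P (s + k * h)} with hN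
  have hN0 : volume N = 0 := by rw [hN, measure_toMeasurable]; exact hPall
  have hNae : ∀ᵐ s, s ∉ N := measure_eq_zero_iff_ae_notMem.1 hN0
  have hNm : MeasurableSet N := measurableSet_toMeasurable _ _
  have hNP : ∀ s, s ∉ N → ∀ k : ℤ, P (s + k * h) := fun s hs => by
    by_contra hcon
    exact hs (subset_toMeasurable _ _ hcon)
  have hinv : ∀ s, s ∉ N → ∀ k : ℤ, 0 < s → 0 < s + k * h →
      μ (timer t (s + k * h)) = μ (timer t s) := by
    intro s hs k hs0
    induction k using Int.induction_on with
    | zero => simp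
    | succ m ih =>
      intro _
      have h0 : (0 : ℝ) ≤ (m : ℤ) * h := by positivity
      have h1 := hNP s hs (m + 1) (by push_cast at h0 ⊢; linarith)
      rw [h1, ← ih (by linarith)]
      congr 2; push_cast; ring
    | pred m ih =>
      intro hpos
      push_cast at hpos ih ⊢
      have h1 := hNP s hs (-m) (by push_cast; linarith)
      rw [← ih (by linarith)]
      push_cast at h1
      rw [h1]
      congr 2; ring
  set L : ℝ → Fin n → ℝ := fun s i => if 0 < s then ℓ (timer t s) i else 0 with hL
  have hB : ∀ (i : Fin n), 0 ≤ B := fun i => (hℓ0 0 i).trans (hℓB 0 i)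
  have hL0 : ∀ s i, 0 ≤ L s i := fun s i => by
    simp only [hL]; split_ifs
    · exact hℓ0 _ _
    · exact le_rfl
  have hLB : ∀ s i, L s i ≤ B := fun s i => by
    simp only [hL]; split_ifs
    · exact hℓB _ _
    · exact hB i
  have hLm : ∀ i, Measurable fun s => L s i := fun i =>
    Measurable.ite measurableSet_Ioi
      ((measurable_pi_apply i).comp (hℓm.comp (measurable_timer ht))) measurable_const
  have hbdd : ∀ s i, BddAbove (range fun k : ℤ => L (s + k * h) i) := fun s i => ⟨B, by
    rintro _ ⟨k, rfl⟩; exact hLB _ _⟩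
  refine ⟨fun s i => if s ∈ N then 0 else ⨆ k : ℤ, L (s + k * h) i, ?_, ?_, ?_, ?_, ?_, ?_⟩
  · refine measurable_pi_iff.2 fun i => Measurable.ite hNm measurable_const ?_
    exact Measurable.iSup fun k => (hLm i).comp (measurable_add_const _)
  · intro s i
    dsimp only
    split_ifs
    · exact le_rfl
    · exact Real.iSup_nonneg fun k => hL0 _ _
  · intro s i
    dsimp only
    split_ifs
    · exact hB i
    · exact ciSup_le fun k => hLB _ _
  · intro s hs i
    dsimp only
    have hμ0 := (hμ.1 _ (timer_mem ht hs) i).le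
    split_ifs with hsN
    · exact hμ0
    · refine ciSup_le fun k => ?_
      simp only [hL]
      split_ifs with hk
      · rw [← hinv s hsN k hs hk]
        exact hℓμ _ (timer_mem ht hk) i
      · exact hμ0
  · filter_upwards [hNae] with s hs hs0 i
    rw [if_neg hs]
    refine le_trans (le_of_eq ?_) (le_ciSup (hbdd s i) 0)
    simp [hL, hs0]
  · have hNae' : ∀ᵐ s, s + h ∉ N :=
      (measurePreserving_add_right volume h).quasiMeasurePreserving.ae hNae
    filter_upwards [hNae, hNae'] with s hs hs'
    ext i
    rw [if_neg hs, if_neg hs']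
    rw [← (Equiv.addRight (1 : ℤ)).iSup_comp (g := fun k : ℤ => L (s + k * h) i)]
    refine iSup_congr fun k => ?_
    congr 1
    simp only [Equiv.coe_addRight]
    push_cast; ring

/-! ### The dissipation inequality -/

theorem norm_le_initNorm {n : ℕ} {hc : ℝ} (hd : ℕ) {φ : ℝ → Fin n → ℝ} (ψ : ℕ → Fin n → ℝ)
    (hφ : ContinuousOn φ (Icc (-hc) 0)) {s : ℝ} (hs : s ∈ Icc (-hc) 0) :
    ‖φ s‖ ≤ initNorm hc hd φ ψ :=
  le_add_of_le_of_nonneg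
    (le_csSup (isCompact_Icc.bddAbove_image hφ.norm) (mem_image_of_mem _ hs))
    (Finset.sum_nonneg fun _ _ => norm_nonneg _)

theorem initNorm_nonneg {n : ℕ} (hc : ℝ) (hd : ℕ) (φ : ℝ → Fin n → ℝ) (ψ : ℕ → Fin n → ℝ) :
    0 ≤ initNorm hc hd φ ψ := by
  refine add_nonneg (Real.sSup_nonneg ?_) (Finset.sum_nonneg fun _ _ => norm_nonneg _)
  rintro _ ⟨s, -, rfl⟩
  exact norm_nonneg _

theorem dotProduct_le_sum_mul_norm {n : ℕ} {u v : Fin n → ℝ} (hu : 0 ≤ u) :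
    u ⬝ᵥ v ≤ (∑ i, u i) * ‖v‖ := by
  rw [Finset.sum_mul]
  exact Finset.sum_le_sum fun i _ =>
    mul_le_mul_of_nonneg_left ((le_abs_self _).trans (norm_le_pi_norm v i)) (hu i)

theorem norm_le_one_dotProduct {n : ℕ} {v : Fin n → ℝ} (hv : 0 ≤ v) : ‖v‖ ≤ 1 ⬝ᵥ v := by
  rw [one_dotProduct]
  refine (pi_norm_le_iff_of_nonneg (Finset.sum_nonneg fun i _ => hv i)).2 fun i => ?_
  rw [Real.norm_of_nonneg (hv i)]
  exact Finset.single_le_sum (fun j _ => hv j) (Finset.mem_univ i)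

theorem _root_.IntervalIntegrable.one_dotProduct {n : ℕ} {v : ℝ → Fin n → ℝ} {a b : ℝ}
    (hv : IntervalIntegrable v volume a b) :
    IntervalIntegrable (fun r => 1 ⬝ᵥ v r) volume a b := by
  have : (fun r => 1 ⬝ᵥ v r) = ∑ i, fun r => v r i := by
    ext r; simp [_root_.one_dotProduct]
  rw [this]
  exact IntervalIntegrable.sum _ fun i _ => hv.eval i

theorem _root_.IntervalIntegrable.dotProduct_of_bounded {n : ℕ} {M v : ℝ → Fin n → ℝ} {a b B : ℝ}
    (hv : IntervalIntegrable v volume a b) (hM : Measurable M) (hB : ∀ r i, |M r i| ≤ B) :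
    IntervalIntegrable (fun r => M r ⬝ᵥ v r) volume a b := by
  have : (fun r => M r ⬝ᵥ v r) = ∑ i, fun r => M r i * v r i := by
    ext r; simp [dotProduct]
  rw [this]
  refine IntervalIntegrable.sum _ fun i _ => ?_
  have hm : ∀ μ : Measure ℝ, AEStronglyMeasurable (fun r => M r i) μ := fun μ =>
    ((measurable_pi_apply i).comp hM).aestronglyMeasurable
  exact ⟨(hv.eval i).1.bdd_mul (hm _) (Eventually.of_forall fun r => hB r i),
    (hv.eval i).2.bdd_mul (hm _) (Eventually.of_forall fun r => hB r i)⟩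

namespace Sys

variable {n pc pd qc qd : ℕ}

/-- The linear inequalities that certify stability and the gain bound `γ`. -/
structure Certificate (S : Sys n pc pd qc qd) (Tmin Tmax : ℝ) (ζ ζ' μc : ℝ → Fin n → ℝ)
    (ε γ : ℝ) : Prop where
  deriv : ∀ τ ∈ Icc 0 Tmax, HasDerivWithinAt ζ (ζ' τ) (Icc 0 Tmax) τ
  pos : ∀ i, 0 < ζ 0 i
  flow_state : ∀ τ ∈ Icc 0 Tmax, ζ' τ + ζ τ ᵥ* S.A τ + μc τ + 1 ᵥ* S.Cc ≤ 0
  flow_delay : ∀ τ ∈ Icc 0 Tmax, ζ τ ᵥ* S.Gc τ - μc τ + 1 ᵥ* S.Hc ≤ 0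
  flow_input : ∀ τ ∈ Icc 0 Tmax, ζ τ ᵥ* S.Ec τ + 1 ᵥ* S.Fc ≤ fun _ => γ
  jump_state : ∀ θ ∈ Icc Tmin Tmax,
    -ζ θ + ζ 0 ᵥ* (S.J + S.Gd) + 1 ᵥ* (S.Cd + S.Hd) ≤ fun _ => -ε
  jump_input : ζ 0 ᵥ* S.Ed + 1 ᵥ* S.Fd ≤ fun _ => γ

/-- A solution with nonnegative data, state and outputs. -/
structure IsNonnegSolution (S : Sys n pc pd qc qd) (hc : ℝ) (hd : ℕ) (t : ℕ → ℝ)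
    (φ : ℝ → Fin n → ℝ) (ψ : ℕ → Fin n → ℝ) (wc : ℝ → Fin pc → ℝ) (wd : ℕ → Fin pd → ℝ)
    (x : ℝ → Fin n → ℝ) : Prop extends S.IsSolution hc hd t φ ψ wc wd x where
  input_locallyIntegrable : LocallyIntegrableOn wc (Ici 0)
  phi_nonneg : ∀ s ∈ Icc (-hc) 0, 0 ≤ φ s
  psi_nonneg : ∀ j, 0 ≤ ψ j
  wc_nonneg : ∀ s, 0 < s → 0 ≤ wc s
  wd_nonneg : ∀ k, 1 ≤ k → 0 ≤ wd k
  state_nonneg : ∀ s, 0 ≤ s → 0 ≤ x s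
  zc_nonneg : ∀ s, 0 < s → 0 ≤ S.zc hc wc x s
  zd_nonneg : ∀ k, 1 ≤ k → 0 ≤ S.zd hd t ψ wd x k

variable {S : Sys n pc pd qc qd} {Tmin Tmax hc ε γ : ℝ} {hd : ℕ} {t : ℕ → ℝ}
  {φ : ℝ → Fin n → ℝ} {ψ : ℕ → Fin n → ℝ} {wc : ℝ → Fin pc → ℝ} {wd : ℕ → Fin pd → ℝ}
  {x ζ ζ' μc : ℝ → Fin n → ℝ}

theorem InternallyPositive.isNonnegSolution (hpos : S.InternallyPositive (rangeDwell Tmin Tmax))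
    (ht : t ∈ rangeDwell Tmin Tmax) (hc0 : 0 < hc) (h : S.IsSolution hc hd t φ ψ wc wd x)
    (hw : LocallyIntegrableOn wc (Ici 0)) (hφ : ∀ s ∈ Icc (-hc) 0, 0 ≤ φ s) (hψ : ∀ j, 0 ≤ ψ j)
    (hwc : ∀ s, 0 < s → 0 ≤ wc s) (hwd : ∀ k, 1 ≤ k → 0 ≤ wd k) :
    S.IsNonnegSolution hc hd t φ ψ wc wd x := by
  obtain ⟨h1, h2, h3⟩ := hpos hc hc0 hd t ht φ ψ wc wd x h hw hφ hψ hwc hwd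
  exact ⟨h, hw, hφ, hψ, hwc, hwd, h1, h2, h3⟩

theorem IsNonnegSolution.nonneg (h : S.IsNonnegSolution hc hd t φ ψ wc wd x) {s : ℝ}
    (hs : -hc ≤ s) : 0 ≤ x s := by
  rcases le_or_gt 0 s with h0 | h0
  · exact h.state_nonneg s h0
  · rw [h.init s ⟨hs, h0.le⟩]; exact h.phi_nonneg s ⟨hs, h0.le⟩

theorem IsNonnegSolution.sample_nonneg (h : S.IsNonnegSolution hc hd t φ ψ wc wd x)
    (ht : t ∈ rangeDwell Tmin Tmax) (k : ℕ) : 0 ≤ sample t hd ψ x k := by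
  rw [sample]
  split_ifs
  · exact h.state_nonneg _ (rangeDwell.nonneg ht _)
  · exact h.psi_nonneg _

theorem intervalIntegrable_input (hw : LocallyIntegrableOn wc (Ici 0)) {a b : ℝ} (ha : 0 ≤ a)
    (hab : a ≤ b) : IntervalIntegrable wc volume a b := by
  rw [intervalIntegrable_iff_integrableOn_Icc_of_le hab]
  exact (hw.mono_set fun r hr => ha.trans hr.1).integrableOn_isCompact isCompact_Icc

theorem IsSolution.intervalIntegrable_zc (h : S.IsSolution hc hd t φ ψ wc wd x) (hc0 : 0 < hc)
    (ht : t ∈ rangeDwell Tmin Tmax) (hw : LocallyIntegrableOn wc (Ici 0)) {a b : ℝ} (ha : 0 ≤ a)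
    (hab : a ≤ b) : IntervalIntegrable (S.zc hc wc x) volume a b :=
  (((h.intervalIntegrable hc0 ht (by linarith) hab).mulVec continuous_const).add
    ((h.intervalIntegrable_delay hc0 ht ha hab).mulVec continuous_const)).add
    ((intervalIntegrable_input hw ha hab).mulVec continuous_const)

/-- The supply rate: an upper bound for the derivative of `ζ ⬝ᵥ x` along the flow. -/
noncomputable def supply (S : Sys n pc pd qc qd) (hc γ : ℝ) (M : ℝ → Fin n → ℝ)
    (wc : ℝ → Fin pc → ℝ) (x : ℝ → Fin n → ℝ) (r : ℝ) : ℝ :=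
  M r ⬝ᵥ x (r - hc) - M r ⬝ᵥ x r - 1 ⬝ᵥ S.zc hc wc x r + γ * 1 ⬝ᵥ wc r

section Multiplier

variable {M : ℝ → Fin n → ℝ} {B : ℝ} (hM : Measurable M) (hM0 : ∀ s i, 0 ≤ M s i)
  (hMB : ∀ s i, M s i ≤ B) (h : S.IsNonnegSolution hc hd t φ ψ wc wd x) (hc0 : 0 < hc)
  (ht : t ∈ rangeDwell Tmin Tmax)

include hM hM0 hMB h hc0 ht

theorem IsNonnegSolution.intervalIntegrable_dotProduct {a b : ℝ} (ha : -hc ≤ a) (hab : a ≤ b) :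
    IntervalIntegrable (fun r => M r ⬝ᵥ x r) volume a b :=
  (h.intervalIntegrable hc0 ht ha hab).dotProduct_of_bounded hM
    fun r i => by rw [abs_of_nonneg (hM0 r i)]; exact hMB r i

theorem IsNonnegSolution.intervalIntegrable_dotProduct_delay {a b : ℝ} (ha : 0 ≤ a)
    (hab : a ≤ b) : IntervalIntegrable (fun r => M r ⬝ᵥ x (r - hc)) volume a b :=
  (h.intervalIntegrable_delay hc0 ht ha hab).dotProduct_of_bounded hM
    fun r i => by rw [abs_of_nonneg (hM0 r i)]; exact hMB r i

theorem IsNonnegSolution.intervalIntegrable_supply {a b : ℝ} (ha : 0 ≤ a) (hab : a ≤ b) :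
    IntervalIntegrable (S.supply hc γ M wc x) volume a b :=
  (((h.intervalIntegrable_dotProduct_delay hM hM0 hMB hc0 ht ha hab).sub
    (h.intervalIntegrable_dotProduct hM hM0 hMB hc0 ht (by linarith) hab)).sub
    (h.intervalIntegrable_zc hc0 ht h.input_locallyIntegrable ha hab).one_dotProduct).add
    ((intervalIntegrable_input h.input_locallyIntegrable ha hab).one_dotProduct.const_mul γ)

/-- Dissipation along the flow between two impulses. -/
theorem IsNonnegSolution.flow_dissipation (hA : ContinuousOn S.A (Icc 0 Tmax))
    (cert : S.Certificate Tmin Tmax ζ ζ' μc ε γ)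
    (hMμ : ∀ s, 0 < s → ∀ i, M s i ≤ μc (timer t s) i)
    (hMG : ∀ᵐ s, 0 < s →
      ∀ i, (ζ (timer t s) ᵥ* S.Gc (timer t s) + 1 ᵥ* S.Hc) i ≤ M s i) (k : ℕ) :
    ζ (t (k + 1) - t k) ⬝ᵥ x (t (k + 1)) - ζ 0 ⬝ᵥ S.post hd t ψ wd x k ≤
      ∫ r in (t k)..(t (k + 1)), S.supply hc γ M wc x r := by
  have hT := (rangeDwell.Tmax_pos ht).le
  have hlt := rangeDwell.lt_succ ht k
  have hk0 := rangeDwell.nonneg ht k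
  set y := S.arc hc hd t ψ wc wd x k with hy
  have hyx : ∀ r ∈ Ioc (t k) (t (k + 1)), y r = x r := fun r hr => h.arc_eq hr
  have hτ : ∀ r ∈ Icc (t k) (t (k + 1)), r - t k ∈ Icc 0 Tmax := fun r hr =>
    rangeDwell.sub_mem ht hr
  have hζc : ContinuousOn ζ (Icc 0 Tmax) := fun τ hτ' => (cert.deriv τ hτ').continuousWithinAt
  have hζkc : ContinuousOn (fun r => ζ (r - t k)) (Icc (t k) (t (k + 1))) :=
    hζc.comp (by fun_prop) hτ
  -- An upper bound for `ζ'` that is integrable; `ζ'` itself need not be.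
  set U : ℝ → Fin n → ℝ := fun r i => -(ζ (clamp Tmax (r - t k)) ᵥ* S.A (clamp Tmax (r - t k))) i
    - M r i - (1 ᵥ* S.Cc) i with hU
  have hUi : ∀ i, IntervalIntegrable (fun r => U r i) volume (t k) (t (k + 1)) := by
    intro i
    have hc1 : Continuous fun r => ζ (clamp Tmax (r - t k)) ᵥ* S.A (clamp Tmax (r - t k)) :=
      ((continuous_comp_clamp hT hζc).comp (continuous_sub_right _)).matrix_vecMul
        ((continuous_comp_clamp hT hA).comp (continuous_sub_right _))
    have hMi : IntervalIntegrable (fun r => M r i) volume (t k) (t (k + 1)) := by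
      have hone : IntervalIntegrable (fun _ => (1 : ℝ)) volume (t k) (t (k + 1)) := by simp
      have hm : ∀ μ : Measure ℝ, AEStronglyMeasurable (fun r => M r i) μ := fun μ =>
        ((measurable_pi_apply i).comp hM).aestronglyMeasurable
      have hb : ∀ r, ‖M r i‖ ≤ B := fun r => by
        rw [Real.norm_of_nonneg (hM0 r i)]; exact hMB r i
      have h1 := hone.1.bdd_mul (hm _) (Eventually.of_forall hb)
      have h2 := hone.2.bdd_mul (hm _) (Eventually.of_forall hb)
      simp only [mul_one] at h1 h2
      exact ⟨h1, h2⟩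
    exact (((((continuous_apply i).comp hc1).neg).intervalIntegrable _ _).sub hMi).sub
      (by simp)
  have hUζ : ∀ i, ∀ s ∈ Icc (t k) (t (k + 1)), ∀ s' ∈ Icc (t k) (t (k + 1)), s ≤ s' →
      ζ (s' - t k) i - ζ (s - t k) i ≤ ∫ r in s..s', U r i := by
    intro i s hs s' hs' hss
    refine intervalIntegral.sub_le_integral_of_hasDeriv_right_of_le (g := fun r => ζ (r - t k) i)
      (g' := fun r => ζ' (r - t k) i) hss ?_ ?_ ?_ ?_
    · exact (continuousOn_pi.1 hζkc i).mono (Icc_subset_Icc hs.1 hs'.2)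
    · intro r hr
      have hr1 : r - t k ∈ Ioo 0 Tmax := by
        have := hτ s hs
        have := hτ s' hs'
        simp only [mem_Icc] at *
        exact ⟨by linarith [hr.1], by linarith [hr.2]⟩
      have hd := ((cert.deriv _ (Ioo_subset_Icc_self hr1)).hasDerivAt
        (Icc_mem_nhds hr1.1 hr1.2))
      have hd2 := hd.scomp r ((hasDerivAt_id r).sub_const (t k))
      simp only [one_smul] at hd2
      exact (hasDerivAt_pi.1 hd2 i).hasDerivWithinAt
    · rw [← intervalIntegrable_iff_integrableOn_Icc_of_le hss]
      refine (hUi i).mono_set ?_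
      rw [uIcc_of_le hlt.le]
      exact uIcc_subset_Icc hs hs'
    · intro r hr
      have hr1 : r ∈ Ioc (t k) (t (k + 1)) :=
        ⟨hs.1.trans_lt hr.1, (hr.2.trans_le hs'.2).le⟩
      have hmem := hτ r (Ioc_subset_Icc_self hr1)
      have h1 := cert.flow_state _ hmem i
      have h2 := hMμ r (hk0.trans_lt hr1.1) i
      rw [timer_eq ht hr1] at h2
      simp only [hU, clamp_eq hmem]
      simp only [Pi.add_apply, Pi.zero_apply] at h1
      linarith
  have hfi := h.flow_integrable k
  have hyc := h.continuousOn_arc ht k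
  have hy0 : ∀ r ∈ Icc (t k) (t (k + 1)), 0 ≤ y r := by
    intro r hr
    rcases hr.1.eq_or_lt with e | e
    · rw [← e, hy, arc_left]
      exact h.post_nonneg ht h.state_nonneg k
    · rw [hyx r ⟨e, hr.2⟩]
      exact h.state_nonneg r (hk0.trans hr.1)
  have hcomp : ∀ i, ζ (t (k + 1) - t k) i * x (t (k + 1)) i - ζ 0 i * S.post hd t ψ wd x k i ≤
      ∫ r in (t k)..(t (k + 1)), (U r i * y r i + ζ (r - t k) i * S.flow hc t wc x k r i) := by
    intro i
    have := mul_sub_mul_le_integral (ζ := fun r => ζ (r - t k) i) (U := fun r => U r i)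
      (x := fun r => y r i) (f := fun r => S.flow hc t wc x k r i) hlt.le
      (continuousOn_pi.1 hζkc i) (hUi i) (hUζ i) (hfi.eval i) (fun s hs => ?_)
      (fun s hs => hy0 s hs i)
    · have e1 : y (t k) = S.post hd t ψ wd x k := arc_left k
      simpa [hyx _ ⟨hlt, le_rfl⟩, e1] using this
    · simp only [hy, arc_left]
      rw [← intervalIntegral_eval (hfi.mono_set (by
        rw [uIcc_of_le hlt.le, uIcc_of_le hs.1]; exact Icc_subset_Icc_right hs.2))]
      rfl
  have hint : ∀ i, IntervalIntegrable
      (fun r => U r i * y r i + ζ (r - t k) i * S.flow hc t wc x k r i) volume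
      (t k) (t (k + 1)) := fun i =>
    ((hUi i).mul_continuousOn (by rw [uIcc_of_le hlt.le]; exact continuousOn_pi.1 hyc i)).add
      ((hfi.eval i).continuousOn_mul
        (by rw [uIcc_of_le hlt.le]; exact continuousOn_pi.1 hζkc i))
  have hsum : ζ (t (k + 1) - t k) ⬝ᵥ x (t (k + 1)) - ζ 0 ⬝ᵥ S.post hd t ψ wd x k ≤
      ∫ r in (t k)..(t (k + 1)),
        ∑ i, (U r i * y r i + ζ (r - t k) i * S.flow hc t wc x k r i) := by
    rw [intervalIntegral.integral_finsetSum fun i _ => hint i]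
    simp only [dotProduct]
    rw [← Finset.sum_sub_distrib]
    exact Finset.sum_le_sum fun i _ => hcomp i
  refine hsum.trans ?_
  have hae : ∀ᵐ r ∂volume.restrict (Icc (t k) (t (k + 1))),
      ∑ i, (U r i * y r i + ζ (r - t k) i * S.flow hc t wc x k r i) ≤ S.supply hc γ M wc x r := by
    rw [restrict_Ioc_eq_restrict_Icc.symm, ae_restrict_iff' measurableSet_Ioc]
    filter_upwards [hMG] with r hr hrI
    have hr0 : 0 < r := hk0.trans_lt hrI.1
    have hG := hr hr0
    rw [timer_eq ht hrI] at hG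
    have hmem := hτ r (Ioc_subset_Icc_self hrI)
    have hE : (ζ (r - t k) ᵥ* S.Ec (r - t k) + 1 ᵥ* S.Fc) ⬝ᵥ wc r ≤
        (fun _ => γ) ⬝ᵥ wc r :=
      dotProduct_le_dotProduct_of_nonneg_right (cert.flow_input _ hmem) (h.wc_nonneg r hr0)
    have hγ : (fun _ => γ) ⬝ᵥ wc r = γ * 1 ⬝ᵥ wc r := by
      simp [dotProduct, Finset.mul_sum]
    have hG' : (ζ (r - t k) ᵥ* S.Gc (r - t k) + 1 ᵥ* S.Hc) ⬝ᵥ x (r - hc) ≤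
        M r ⬝ᵥ x (r - hc) :=
      dotProduct_le_dotProduct_of_nonneg_right hG (h.nonneg (by linarith))
    have e1 : ∑ i, (U r i * y r i + ζ (r - t k) i * S.flow hc t wc x k r i) =
        U r ⬝ᵥ x r + ζ (r - t k) ⬝ᵥ S.flow hc t wc x k r := by
      rw [Finset.sum_add_distrib, hyx r hrI]; rfl
    have e2 : U r = -(ζ (r - t k) ᵥ* S.A (r - t k)) - M r - 1 ᵥ* S.Cc := by
      ext i; simp only [hU, clamp_eq hmem, Pi.sub_apply, Pi.neg_apply]
    rw [hγ] at hE
    rw [e1, e2, supply]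
    simp only [flow, zc, dotProduct_add, add_dotProduct, sub_dotProduct, neg_dotProduct,
      Matrix.dotProduct_mulVec] at hE hG' ⊢
    linarith
  exact intervalIntegral.integral_mono_ae_restrict hlt.le
    (by
      have := IntervalIntegrable.sum Finset.univ fun i (_ : i ∈ Finset.univ) => hint i
      simpa only [Finset.sum_fn] using this)
    (h.intervalIntegrable_supply hM hM0 hMB hc0 ht hk0 hlt.le) hae

end Multiplier

end Sys

namespace Sys

variable {n pc pd qc qd : ℕ} {S : Sys n pc pd qc qd} {Tmin Tmax hc ε γ : ℝ} {hd : ℕ} {t : ℕ → ℝ}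
  {φ : ℝ → Fin n → ℝ} {ψ : ℕ → Fin n → ℝ} {wc : ℝ → Fin pc → ℝ} {wd : ℕ → Fin pd → ℝ}
  {x ζ ζ' μc : ℝ → Fin n → ℝ}

theorem const_dotProduct {m : ℕ} (c : ℝ) (v : Fin m → ℝ) : (fun _ => c) ⬝ᵥ v = c * 1 ⬝ᵥ v := by
  simp [dotProduct, Finset.mul_sum]

/-- Dissipation at an impulse, with the multiplier `ζ(0)ᵀ Gd + 1ᵀ Hd` for the delayed samples. -/
theorem IsNonnegSolution.jump_dissipation (h : S.IsNonnegSolution hc hd t φ ψ wc wd x)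
    (ht : t ∈ rangeDwell Tmin Tmax) (cert : S.Certificate Tmin Tmax ζ ζ' μc ε γ) (k : ℕ) :
    ζ 0 ⬝ᵥ S.post hd t ψ wd x (k + 1) + ε * 1 ⬝ᵥ x (t (k + 1)) +
        1 ⬝ᵥ S.zd hd t ψ wd x (k + 1) ≤
      ζ (t (k + 1) - t k) ⬝ᵥ x (t (k + 1)) +
        (ζ 0 ᵥ* S.Gd + 1 ᵥ* S.Hd) ⬝ᵥ sample t hd ψ x (k + 1) -
        (ζ 0 ᵥ* S.Gd + 1 ᵥ* S.Hd) ⬝ᵥ x (t (k + 1)) + γ * 1 ⬝ᵥ wd (k + 1) := by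
  have h1 := dotProduct_le_dotProduct_of_nonneg_right (cert.jump_state _ (ht.2.2.1 k))
    (h.state_nonneg _ (rangeDwell.nonneg ht (k + 1)))
  have h2 := dotProduct_le_dotProduct_of_nonneg_right cert.jump_input
    (h.wd_nonneg (k + 1) (by omega))
  rw [const_dotProduct] at h1 h2
  simp only [post, zd, Nat.add_one_ne_zero, if_false]
  simp only [Matrix.vecMul_add, dotProduct_add, add_dotProduct, neg_dotProduct,
    Matrix.dotProduct_mulVec] at h1 h2 ⊢
  linarith

/-- The dissipation inequality summed over the first `K` intervals. -/
theorem IsNonnegSolution.sum_dissipation {M : ℝ → Fin n → ℝ} {B : ℝ} (hM : Measurable M)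
    (hM0 : ∀ s i, 0 ≤ M s i) (hMB : ∀ s i, M s i ≤ B)
    (h : S.IsNonnegSolution hc hd t φ ψ wc wd x) (hc0 : 0 < hc) (ht : t ∈ rangeDwell Tmin Tmax)
    (hA : ContinuousOn S.A (Icc 0 Tmax)) (cert : S.Certificate Tmin Tmax ζ ζ' μc ε γ)
    (hMμ : ∀ s, 0 < s → ∀ i, M s i ≤ μc (timer t s) i)
    (hMG : ∀ᵐ s, 0 < s →
      ∀ i, (ζ (timer t s) ᵥ* S.Gc (timer t s) + 1 ᵥ* S.Hc) i ≤ M s i) (K : ℕ) :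
    ζ 0 ⬝ᵥ S.post hd t ψ wd x K + ε * ∑ k ∈ Finset.range K, 1 ⬝ᵥ x (t (k + 1)) +
        ∑ k ∈ Finset.range K, 1 ⬝ᵥ S.zd hd t ψ wd x (k + 1) ≤
      ζ 0 ⬝ᵥ x 0 + (∫ r in (0:ℝ)..(t K), S.supply hc γ M wc x r) +
        (∑ k ∈ Finset.range K, (ζ 0 ᵥ* S.Gd + 1 ᵥ* S.Hd) ⬝ᵥ sample t hd ψ x (k + 1) -
          ∑ k ∈ Finset.range K, (ζ 0 ᵥ* S.Gd + 1 ᵥ* S.Hd) ⬝ᵥ x (t (k + 1))) +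
        γ * ∑ k ∈ Finset.range K, 1 ⬝ᵥ wd (k + 1) := by
  induction K with
  | zero => simp [ht.1, post]
  | succ K ih =>
    have h1 := h.flow_dissipation hM hM0 hMB hc0 ht hA cert hMμ hMG K
    have h2 := h.jump_dissipation ht cert K
    have hK := rangeDwell.nonneg ht K
    have h3 := intervalIntegral.integral_add_adjacent_intervals
      (h.intervalIntegrable_supply (γ := γ) hM hM0 hMB hc0 ht le_rfl hK)
      (h.intervalIntegrable_supply (γ := γ) hM hM0 hMB hc0 ht hK (rangeDwell.lt_succ ht K).le)
    simp only [Finset.sum_range_succ, mul_add]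
    linarith

/-- The delayed term of the supply rate is compensated by the undelayed one, up to the contribution
of the initial function. This is where the invariance of the multiplier under the delay enters. -/
theorem IsNonnegSolution.integral_delay_le {M : ℝ → Fin n → ℝ} {B : ℝ} (hM : Measurable M)
    (hM0 : ∀ s i, 0 ≤ M s i) (hMB : ∀ s i, M s i ≤ B) (hB : 0 ≤ B)
    (h : S.IsNonnegSolution hc hd t φ ψ wc wd x) (hc0 : 0 < hc) (ht : t ∈ rangeDwell Tmin Tmax)
    (hMinv : ∀ᵐ s, M (s + hc) = M s) {T : ℝ} (hT : 0 ≤ T) :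
    ∫ r in (0:ℝ)..T, M r ⬝ᵥ x (r - hc) ≤
      (∫ r in (0:ℝ)..T, M r ⬝ᵥ x r) + n * B * hc * initNorm hc hd φ ψ := by
  have hpast : ∀ b, 0 ≤ b → b ≤ hc → ∫ r in (0:ℝ)..b, M r ⬝ᵥ x (r - hc) ≤
      n * B * hc * initNorm hc hd φ ψ := by
    intro b hb hbc
    have hI := initNorm_nonneg hc hd φ ψ
    have : ∫ r in (0:ℝ)..b, M r ⬝ᵥ x (r - hc) ≤
        ∫ r in (0:ℝ)..b, n * B * initNorm hc hd φ ψ := by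
      refine intervalIntegral.integral_mono_on hb
        (h.intervalIntegrable_dotProduct_delay hM hM0 hMB hc0 ht le_rfl hb) (by simp)
        fun r hr => ?_
      have hmem : r - hc ∈ Icc (-hc) 0 := ⟨by linarith [hr.1], by linarith [hr.2]⟩
      rw [h.init _ hmem]
      refine (dotProduct_le_sum_mul_norm (hM0 r)).trans ?_
      have h1 : ∑ i, M r i ≤ n * B := by
        refine (Finset.sum_le_sum fun i _ => hMB r i).trans ?_
        simp
      exact mul_le_mul h1 (norm_le_initNorm hd ψ h.phi_cont hmem) (norm_nonneg _) (by positivity)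
    refine this.trans ?_
    rw [intervalIntegral.integral_const, sub_zero, smul_eq_mul]
    calc b * (n * B * initNorm hc hd φ ψ) ≤ hc * (n * B * initNorm hc hd φ ψ) := by gcongr
      _ = _ := by ring
  have hnn : ∀ r, 0 ≤ r → 0 ≤ M r ⬝ᵥ x r := fun r hr =>
    dotProduct_nonneg_of_nonneg (hM0 r) (h.state_nonneg r hr)
  rcases le_total T hc with hTc | hTc
  · have := intervalIntegral.integral_nonneg (μ := volume) hT fun r hr => hnn r hr.1
    linarith [hpast T hT hTc]
  · have h1 := intervalIntegral.integral_add_adjacent_intervals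
      (h.intervalIntegrable_dotProduct_delay hM hM0 hMB hc0 ht le_rfl hc0.le)
      (h.intervalIntegrable_dotProduct_delay hM hM0 hMB hc0 ht hc0.le hTc)
    have h2 : ∫ r in hc..T, M r ⬝ᵥ x (r - hc) = ∫ r in (0:ℝ)..(T - hc), M r ⬝ᵥ x r := by
      have e := intervalIntegral.integral_comp_sub_right (a := hc) (b := T)
        (fun s => M (s + hc) ⬝ᵥ x s) hc
      simp only [sub_add_cancel, sub_self] at e
      rw [e]
      refine intervalIntegral.integral_congr_ae ?_
      filter_upwards [hMinv] with s hs _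
      rw [hs]
    have h3 : ∫ r in (0:ℝ)..(T - hc), M r ⬝ᵥ x r ≤ ∫ r in (0:ℝ)..T, M r ⬝ᵥ x r := by
      refine intervalIntegral.integral_mono_interval le_rfl (by linarith) (by linarith) ?_
        (h.intervalIntegrable_dotProduct hM hM0 hMB hc0 ht (by linarith) hT)
      exact (ae_restrict_mem measurableSet_Ioc).mono fun r hr => hnn r hr.1.le
    linarith [hpast hc hc0.le le_rfl]

/-- The delayed samples are compensated by the undelayed ones, up to the initial data. -/
theorem IsNonnegSolution.sum_sample_le (h : S.IsNonnegSolution hc hd t φ ψ wc wd x)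
    (hc0 : 0 < hc) (ht : t ∈ rangeDwell Tmin Tmax) {μ : Fin n → ℝ} (hμ : 0 ≤ μ) (K : ℕ) :
    ∑ k ∈ Finset.range K, μ ⬝ᵥ sample t hd ψ x (k + 1) ≤
      ∑ k ∈ Finset.range K, μ ⬝ᵥ x (t (k + 1)) + (∑ i, μ i) * initNorm hc hd φ ψ := by
  have hnn : ∀ k, 0 ≤ μ ⬝ᵥ sample t hd ψ x (k + 1) := fun k =>
    dotProduct_nonneg_of_nonneg hμ (h.sample_nonneg ht _)
  have hμs : 0 ≤ ∑ i, μ i := Finset.sum_nonneg fun i _ => hμ i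
  -- Adding `hd` nonnegative terms makes the shifted sum split into the prescribed samples and `K`
  -- undelayed ones, also when `K < hd`.
  have h1 : ∑ k ∈ Finset.range K, μ ⬝ᵥ sample t hd ψ x (k + 1) ≤
      ∑ k ∈ Finset.range (hd + K), μ ⬝ᵥ sample t hd ψ x (k + 1) :=
    Finset.sum_le_sum_of_subset_of_nonneg (Finset.range_mono (by omega)) fun k _ _ => hnn k
  rw [Finset.sum_range_add] at h1
  have h2 : ∀ k, sample t hd ψ x (hd + k + 1) = x (t (k + 1)) := by
    intro k
    rw [sample, if_pos (by omega)]
    congr 2; omega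
  simp only [h2] at h1
  have h3 : ∑ k ∈ Finset.range hd, μ ⬝ᵥ sample t hd ψ x (k + 1) ≤
      (∑ i, μ i) * initNorm hc hd φ ψ := by
    cases hd with
    | zero => simpa using mul_nonneg hμs (initNorm_nonneg hc 0 φ ψ)
    | succ m =>
      rw [Finset.sum_range_succ, initNorm, mul_add, add_comm]
      refine add_le_add ?_ ?_
      · rw [sample, if_pos le_rfl, Nat.sub_self, ht.1]
        have hmem : (0:ℝ) ∈ Icc (-hc) 0 := ⟨by linarith, le_rfl⟩
        rw [h.init 0 hmem]
        refine (dotProduct_le_sum_mul_norm hμ).trans (mul_le_mul_of_nonneg_left ?_ hμs)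
        exact le_csSup (isCompact_Icc.bddAbove_image h.phi_cont.norm) (mem_image_of_mem _ hmem)
      · rw [Finset.mul_sum, Finset.sum_Ico_eq_sum_range, Nat.add_sub_cancel,
          ← Finset.sum_range_reflect]
        refine Finset.sum_le_sum fun k hk => ?_
        have hk' := Finset.mem_range.1 hk
        rw [sample, if_neg (by omega)]
        refine (dotProduct_le_sum_mul_norm hμ).trans (mul_le_mul_of_nonneg_left ?_ hμs)
        rw [show m + 1 - (m - 1 - k + 1) = 1 + k by omega]
  linarith

/-- The outputs and the sampled states on the first `K` intervals are bounded by `γ` times the inputs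
plus `C` times the size of the initial data, for all `K`. -/
def DissipationBound (S : Sys n pc pd qc qd) (hc : ℝ) (hd : ℕ) (ε γ C : ℝ) (t : ℕ → ℝ)
    (φ : ℝ → Fin n → ℝ) (ψ : ℕ → Fin n → ℝ) (wc : ℝ → Fin pc → ℝ) (wd : ℕ → Fin pd → ℝ)
    (x : ℝ → Fin n → ℝ) : Prop :=
  ∀ K : ℕ, ε * ∑ k ∈ Finset.range K, 1 ⬝ᵥ x (t (k + 1)) +
      (∫ r in (0:ℝ)..(t K), 1 ⬝ᵥ S.zc hc wc x r) +
      ∑ k ∈ Finset.range K, 1 ⬝ᵥ S.zd hd t ψ wd x (k + 1) ≤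
    γ * ((∫ r in (0:ℝ)..(t K), 1 ⬝ᵥ wc r) + ∑ k ∈ Finset.range K, 1 ⬝ᵥ wd (k + 1)) +
      C * initNorm hc hd φ ψ

/-- The certificate bounds outputs and sampled states of nonnegative solutions in terms of the
inputs and the initial data, uniformly over the impulse-time sequences. -/
theorem Certificate.exists_dissipation_bound (cert : S.Certificate Tmin Tmax ζ ζ' μc ε γ)
    (hA : ContinuousOn S.A (Icc 0 Tmax)) (hG : ContinuousOn S.Gc (Icc 0 Tmax))
    (hE : ContinuousOn S.Ec (Icc 0 Tmax))
    (hpos : S.InternallyPositive (rangeDwell Tmin Tmax)) (hT : 0 ≤ Tmax) (hc0 : 0 < hc) (hd : ℕ) :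
    ∃ C : ℝ, 0 ≤ C ∧ ∀ t ∈ rangeDwell Tmin Tmax, μc ∈ timerScalings n Tmax hc t →
      ∀ φ ψ wc wd x, S.IsNonnegSolution hc hd t φ ψ wc wd x →
        S.DissipationBound hc hd ε γ C t φ ψ wc wd x := by
  have hζc : ContinuousOn ζ (Icc 0 Tmax) := fun τ hτ' => (cert.deriv τ hτ').continuousWithinAt
  set ℓ : ℝ → Fin n → ℝ := fun τ i =>
    max 0 ((ζ (clamp Tmax τ) ᵥ* S.Gc (clamp Tmax τ) + 1 ᵥ* S.Hc) i) with hℓ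
  have hℓc : Continuous ℓ := by
    refine continuous_pi fun i => continuous_const.max ((continuous_apply i).comp ?_)
    exact ((continuous_comp_clamp hT hζc).matrix_vecMul
      (continuous_comp_clamp hT hG)).add continuous_const
  have hℓ0 : ∀ τ i, 0 ≤ ℓ τ i := fun τ i => le_max_left _ _
  obtain ⟨B, hB⟩ := isCompact_Icc.exists_bound_of_continuousOn (s := Icc 0 Tmax) hℓc.continuousOn
  have hB0 : 0 ≤ B := (norm_nonneg _).trans (hB 0 ⟨le_rfl, hT⟩)
  have hℓB : ∀ τ i, ℓ τ i ≤ B := by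
    intro τ i
    have h1 := hB _ (clamp_mem hT τ)
    have h2 : ℓ (clamp Tmax τ) = ℓ τ := by simp only [hℓ, clamp_eq (clamp_mem hT τ)]
    rw [h2] at h1
    exact (le_abs_self _).trans ((norm_le_pi_norm (ℓ τ) i).trans h1)
  set μd : Fin n → ℝ := ζ 0 ᵥ* S.Gd + 1 ᵥ* S.Hd with hμd
  refine ⟨(∑ i, ζ 0 i) + n * B * hc + ∑ i, |μd i|,
    add_nonneg (add_nonneg (Finset.sum_nonneg fun i _ => (cert.pos i).le) (by positivity))
      (Finset.sum_nonneg fun i _ => abs_nonneg _), ?_⟩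
  intro t ht hμ φ ψ wc wd x h K
  have hζ0 : 0 ≤ ζ 0 := fun i => (cert.pos i).le
  obtain ⟨hGd, hHd⟩ := InternallyPositive.Gd_Hd_nonneg hA hG hE hpos ht
  have hμd0 : 0 ≤ μd := fun i => add_nonneg
    (dotProduct_nonneg_of_nonneg hζ0 fun j => hGd j i)
    (dotProduct_nonneg_of_nonneg zero_le_one fun j => hHd j i)
  obtain ⟨M, hM, hM0, hMB, hMμ, hMG, hMinv⟩ := timerScalings.exists_multiplier hc0 ht hμ
    hℓc.measurable hℓ0 hℓB (fun τ hτ i => by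
      simp only [hℓ, clamp_eq hτ]
      refine max_le (hμ.1 τ hτ i).le ?_
      have := cert.flow_delay τ hτ i
      simp only [Pi.add_apply, Pi.sub_apply, Pi.zero_apply] at this ⊢
      linarith)
  have hMG' : ∀ᵐ s, 0 < s →
      ∀ i, (ζ (timer t s) ᵥ* S.Gc (timer t s) + 1 ᵥ* S.Hc) i ≤ M s i := by
    filter_upwards [hMG] with s hs hs0 i
    have := hs hs0 i
    simp only [hℓ, clamp_eq (timer_mem ht hs0)] at this
    exact (le_max_right _ _).trans this
  have hK := rangeDwell.nonneg ht K
  have hmain := h.sum_dissipation hM hM0 hMB hc0 ht hA cert hMμ hMG' K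
  have hdel := h.integral_delay_le hM hM0 hMB hB0 hc0 ht hMinv hK
  have hsam := h.sum_sample_le hc0 ht hμd0 K
  have hpost : 0 ≤ ζ 0 ⬝ᵥ S.post hd t ψ wd x K :=
    dotProduct_nonneg_of_nonneg hζ0 (h.post_nonneg ht h.state_nonneg K)
  have hx0 : ζ 0 ⬝ᵥ x 0 ≤ (∑ i, ζ 0 i) * initNorm hc hd φ ψ := by
    have hmem : (0:ℝ) ∈ Icc (-hc) 0 := ⟨by linarith, le_rfl⟩
    rw [h.init 0 hmem]
    exact (dotProduct_le_sum_mul_norm hζ0).trans (mul_le_mul_of_nonneg_left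
      (norm_le_initNorm hd ψ h.phi_cont hmem) (Finset.sum_nonneg fun i _ => hζ0 i))
  have i1 := h.intervalIntegrable_dotProduct_delay hM hM0 hMB hc0 ht le_rfl hK
  have i2 := h.intervalIntegrable_dotProduct hM hM0 hMB hc0 ht (by linarith) hK
  have i3 := (h.intervalIntegrable_zc hc0 ht h.input_locallyIntegrable le_rfl hK).one_dotProduct
  have i4 := (intervalIntegrable_input h.input_locallyIntegrable le_rfl hK).one_dotProduct
  have hsup : ∫ r in (0:ℝ)..(t K), S.supply hc γ M wc x r =
      (∫ r in (0:ℝ)..(t K), M r ⬝ᵥ x (r - hc)) - (∫ r in (0:ℝ)..(t K), M r ⬝ᵥ x r) -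
        (∫ r in (0:ℝ)..(t K), 1 ⬝ᵥ S.zc hc wc x r) + γ * ∫ r in (0:ℝ)..(t K), 1 ⬝ᵥ wc r := by
    simp only [supply]
    rw [intervalIntegral.integral_add ((i1.sub i2).sub i3) (i4.const_mul γ),
      intervalIntegral.integral_sub (i1.sub i2) i3, intervalIntegral.integral_sub i1 i2,
      intervalIntegral.integral_const_mul]
  have habs : ∑ i, |μd i| = ∑ i, μd i :=
    Finset.sum_congr rfl fun i _ => abs_of_nonneg (hμd0 i)
  rw [hsup] at hmain
  rw [habs]
  simp only [add_mul, mul_add]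
  linarith

end Sys

/-! ### Decomposition into nonnegative solutions -/

theorem initNorm_mono {n : ℕ} {hc : ℝ} {hd : ℕ} {φ φ₁ : ℝ → Fin n → ℝ} {ψ ψ₁ : ℕ → Fin n → ℝ}
    (hc0 : 0 < hc) (hφ : ContinuousOn φ (Icc (-hc) 0)) (h1 : ∀ s, ‖φ₁ s‖ ≤ ‖φ s‖)
    (h2 : ∀ j, ‖ψ₁ j‖ ≤ ‖ψ j‖) : initNorm hc hd φ₁ ψ₁ ≤ initNorm hc hd φ ψ := by
  refine add_le_add (csSup_le ((nonempty_Icc.2 (by linarith)).image _) ?_)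
    (Finset.sum_le_sum fun j _ => h2 j)
  rintro _ ⟨s, hs, rfl⟩
  exact (h1 s).trans (le_csSup (isCompact_Icc.bddAbove_image hφ.norm) (mem_image_of_mem _ hs))

theorem norm_posPart_le {n : ℕ} (v : Fin n → ℝ) : ‖v⁺‖ ≤ ‖v‖ := by
  refine (pi_norm_le_iff_of_nonneg (norm_nonneg v)).2 fun i => ?_
  rw [Pi.posPart_apply, Real.norm_of_nonneg (posPart_nonneg _)]
  exact (sup_le (le_abs_self _) (abs_nonneg _)).trans (norm_le_pi_norm v i)

theorem norm_negPart_le {n : ℕ} (v : Fin n → ℝ) : ‖v⁻‖ ≤ ‖v‖ := by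
  rw [← posPart_neg, ← norm_neg v]
  exact norm_posPart_le _

theorem norm1_eq_posPart_add_negPart {n : ℕ} (v : Fin n → ℝ) :
    norm1 v = 1 ⬝ᵥ v⁺ + 1 ⬝ᵥ v⁻ := by
  rw [one_dotProduct, one_dotProduct, ← Finset.sum_add_distrib, norm1]
  exact Finset.sum_congr rfl fun i _ => (posPart_add_negPart (v i)).symm

theorem norm1_sub_le {n : ℕ} {u v : Fin n → ℝ} (hu : 0 ≤ u) (hv : 0 ≤ v) :
    norm1 (u - v) ≤ 1 ⬝ᵥ u + 1 ⬝ᵥ v := by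
  rw [one_dotProduct, one_dotProduct, ← Finset.sum_add_distrib, norm1]
  refine Finset.sum_le_sum fun i _ => (abs_sub _ _).trans (le_of_eq ?_)
  rw [abs_of_nonneg (hu i), abs_of_nonneg (hv i)]

theorem norm1_nonneg {n : ℕ} (v : Fin n → ℝ) : 0 ≤ norm1 v :=
  Finset.sum_nonneg fun _ _ => abs_nonneg _

theorem one_dotProduct_nonneg {n : ℕ} {v : Fin n → ℝ} (hv : 0 ≤ v) : 0 ≤ 1 ⬝ᵥ v :=
  dotProduct_nonneg_of_nonneg zero_le_one hv

theorem integrable_posPart {n : ℕ} {w : ℝ → Fin n → ℝ} {μ : Measure ℝ} (hw : Integrable w μ) :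
    Integrable w⁺ μ :=
  Integrable.of_eval fun i => (hw.eval i).pos_part

theorem integrable_negPart {n : ℕ} {w : ℝ → Fin n → ℝ} {μ : Measure ℝ} (hw : Integrable w μ) :
    Integrable w⁻ μ := by
  rw [← posPart_neg]; exact integrable_posPart hw.neg

theorem _root_.MeasureTheory.Integrable.one_dotProduct {n : ℕ} {v : ℝ → Fin n → ℝ}
    {μ : Measure ℝ} (hv : Integrable v μ) : Integrable (fun r => 1 ⬝ᵥ v r) μ := by
  simp only [_root_.one_dotProduct]
  exact integrable_finsetSum _ fun i _ => hv.eval i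

theorem integrable_norm1 {n : ℕ} {v : ℝ → Fin n → ℝ} {μ : Measure ℝ} (hv : Integrable v μ) :
    Integrable (fun r => norm1 (v r)) μ :=
  integrable_finsetSum _ fun i _ => (hv.eval i).abs

namespace Sys

variable {n pc pd qc qd : ℕ} {S : Sys n pc pd qc qd} {Tmin Tmax hc ε γ : ℝ} {hd : ℕ} {t : ℕ → ℝ}
  {φ : ℝ → Fin n → ℝ} {ψ : ℕ → Fin n → ℝ} {wc : ℝ → Fin pc → ℝ} {wd : ℕ → Fin pd → ℝ}
  {x : ℝ → Fin n → ℝ}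

/-- By linearity and existence of solutions, every solution is the difference of two nonnegative
ones, driven by the positive and the negative parts of the data. -/
theorem IsSolution.exists_sub_eq (h : S.IsSolution hc hd t φ ψ wc wd x)
    (hA : ContinuousOn S.A (Icc 0 Tmax)) (hG : ContinuousOn S.Gc (Icc 0 Tmax))
    (hE : ContinuousOn S.Ec (Icc 0 Tmax))
    (hpos : S.InternallyPositive (rangeDwell Tmin Tmax)) (ht : t ∈ rangeDwell Tmin Tmax)
    (hc0 : 0 < hc) (hw : LocallyIntegrableOn wc (Ici 0)) :
    ∃ x₁ x₂, S.IsNonnegSolution hc hd t φ⁺ ψ⁺ wc⁺ wd⁺ x₁ ∧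
      S.IsNonnegSolution hc hd t φ⁻ ψ⁻ wc⁻ wd⁻ x₂ ∧ x = x₁ - x₂ := by
  have hwp : LocallyIntegrableOn wc⁺ (Ici 0) := fun s hs =>
    let ⟨u, hu, hi⟩ := hw s hs
    ⟨u, hu, integrable_posPart hi⟩
  have hwn : LocallyIntegrableOn wc⁻ (Ici 0) := fun s hs =>
    let ⟨u, hu, hi⟩ := hw s hs
    ⟨u, hu, integrable_negPart hi⟩
  have hφp : ContinuousOn φ⁺ (Icc (-hc) 0) := 
    continuousOn_pi.2 fun i => (continuousOn_pi.1 h.phi_cont i).sup continuousOn_const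
  obtain ⟨x₁, hx₁⟩ := S.exists_isSolution hA hG hE ht hc0 hd hφp ψ⁺ hwp wd⁺
  have hsub : ∀ {α : Type} [AddCommGroup α] [Lattice α] [IsOrderedAddMonoid α] (a : α),
      a⁺ - a = a⁻ := fun a => by
    have := posPart_sub_negPart a
    rw [sub_eq_iff_eq_add] at this ⊢
    rw [this]; abel
  have hx₂ := hx₁.sub ht h
  rw [hsub, hsub, hsub, hsub] at hx₂
  refine ⟨x₁, x₁ - x, ?_, ?_, by abel⟩
  · exact hpos.isNonnegSolution ht hc0 hx₁ hwp (fun s _ => posPart_nonneg (φ s))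
      (fun j => posPart_nonneg (ψ j)) (fun s _ => posPart_nonneg (wc s))
      (fun k _ => posPart_nonneg (wd k))
  · exact hpos.isNonnegSolution ht hc0 hx₂ hwn (fun s _ => negPart_nonneg (φ s))
      (fun j => negPart_nonneg (ψ j)) (fun s _ => negPart_nonneg (wc s))
      (fun k _ => negPart_nonneg (wd k))

/-! ### Gain and stability -/

/-- The gain estimate for nonnegative solutions, where `1`-norms of outputs are linear: the limit of
the dissipation bound over the first `K` intervals. -/
theorem IsNonnegSolution.gain {C : ℝ} (h : S.IsNonnegSolution hc hd t φ ψ wc wd x)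
    (hc0 : 0 < hc) (ht : t ∈ rangeDwell Tmin Tmax) (hε : 0 < ε) (hγ : 0 < γ)
    (hC : S.DissipationBound hc hd ε γ C t φ ψ wc wd x) (hw : IntegrableOn wc (Ioi 0))
    (hwd : Summable fun k => 1 ⬝ᵥ wd (k + 1)) :
    IntegrableOn (S.zc hc wc x) (Ioi 0) ∧
      Summable (fun k => 1 ⬝ᵥ S.zd hd t ψ wd x (k + 1)) ∧
      (∫ s in Ioi 0, 1 ⬝ᵥ S.zc hc wc x s) + ∑' k, 1 ⬝ᵥ S.zd hd t ψ wd x (k + 1) ≤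
        γ * ((∫ s in Ioi 0, 1 ⬝ᵥ wc s) + ∑' k, 1 ⬝ᵥ wd (k + 1)) + C * initNorm hc hd φ ψ := by
  have hw1 : IntegrableOn (fun s => 1 ⬝ᵥ wc s) (Ioi 0) := hw.one_dotProduct
  have hwd0 : ∀ k, 0 ≤ 1 ⬝ᵥ wd (k + 1) := fun k =>
    one_dotProduct_nonneg (h.wd_nonneg (k + 1) (by omega))
  have hzd0 : ∀ k, 0 ≤ 1 ⬝ᵥ S.zd hd t ψ wd x (k + 1) := fun k =>
    one_dotProduct_nonneg (h.zd_nonneg (k + 1) (by omega))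
  have hx0 : ∀ k, 0 ≤ 1 ⬝ᵥ x (t (k + 1)) := fun k =>
    one_dotProduct_nonneg (h.state_nonneg _ (rangeDwell.nonneg ht _))
  have ht0 := rangeDwell.nonneg ht
  have hzc : ∀ K, IntervalIntegrable (S.zc hc wc x) volume 0 (t K) := fun K =>
    h.intervalIntegrable_zc hc0 ht h.input_locallyIntegrable le_rfl (ht0 K)
  have hzc0 : ∀ K, 0 ≤ ∫ r in (0:ℝ)..(t K), 1 ⬝ᵥ S.zc hc wc x r := fun K => by
    rw [intervalIntegral.integral_of_le (ht0 K)]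
    exact setIntegral_nonneg measurableSet_Ioc fun r hr =>
      one_dotProduct_nonneg (h.zc_nonneg r hr.1)
  have hzdsum0 : ∀ K, 0 ≤ ∑ k ∈ Finset.range K, 1 ⬝ᵥ S.zd hd t ψ wd x (k + 1) := fun K =>
    Finset.sum_nonneg fun k _ => hzd0 k
  have hbase : ∀ K, (∫ r in (0:ℝ)..(t K), 1 ⬝ᵥ S.zc hc wc x r) +
        ∑ k ∈ Finset.range K, 1 ⬝ᵥ S.zd hd t ψ wd x (k + 1) ≤
      γ * ((∫ r in (0:ℝ)..(t K), 1 ⬝ᵥ wc r) + ∑ k ∈ Finset.range K, 1 ⬝ᵥ wd (k + 1)) +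
        C * initNorm hc hd φ ψ := fun K => by
    have := hC K
    have h2 := mul_nonneg hε.le (Finset.sum_nonneg (s := Finset.range K) fun k _ => hx0 k)
    linarith
  set R := γ * ((∫ s in Ioi 0, 1 ⬝ᵥ wc s) + ∑' k, 1 ⬝ᵥ wd (k + 1)) + C * initNorm hc hd φ ψ
    with hR
  have hbound : ∀ K, (∫ r in (0:ℝ)..(t K), 1 ⬝ᵥ S.zc hc wc x r) +
        ∑ k ∈ Finset.range K, 1 ⬝ᵥ S.zd hd t ψ wd x (k + 1) ≤ R := by
    intro K
    refine (hbase K).trans ?_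
    rw [hR]
    gcongr
    · rw [intervalIntegral.integral_of_le (ht0 K)]
      refine setIntegral_mono_set hw1 ?_ Ioc_subset_Ioi_self.eventuallyLE
      exact (ae_restrict_mem measurableSet_Ioi).mono fun r hr =>
        one_dotProduct_nonneg (h.wc_nonneg r hr)
    · exact hwd.sum_le_tsum _ fun k _ => hwd0 k
  have hint : IntegrableOn (S.zc hc wc x) (Ioi 0) := by
    refine integrableOn_Ioi_of_intervalIntegral_norm_bounded R 0
      (fun K => (intervalIntegrable_iff_integrableOn_Ioc_of_le (ht0 K)).1 (hzc K)) ht.2.2.2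
      (Eventually.of_forall fun K => ?_)
    have h1 : ∫ r in (0:ℝ)..(t K), ‖S.zc hc wc x r‖ ≤
        ∫ r in (0:ℝ)..(t K), 1 ⬝ᵥ S.zc hc wc x r :=
      intervalIntegral.integral_mono_on_of_le_Ioo (ht0 K) (hzc K).norm (hzc K).one_dotProduct
        fun r hr => norm_le_one_dotProduct (h.zc_nonneg r hr.1)
    linarith [hbound K, hzdsum0 K]
  have hsum : Summable fun k => 1 ⬝ᵥ S.zd hd t ψ wd x (k + 1) :=
    summable_of_sum_range_le (c := R) hzd0 fun K => by linarith [hbound K, hzc0 K]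
  refine ⟨hint, hsum, ?_⟩
  have hlim : Tendsto (fun K => (∫ r in (0:ℝ)..(t K), 1 ⬝ᵥ S.zc hc wc x r) +
      ∑ k ∈ Finset.range K, 1 ⬝ᵥ S.zd hd t ψ wd x (k + 1)) atTop
      (𝓝 ((∫ s in Ioi 0, 1 ⬝ᵥ S.zc hc wc x s) + ∑' k, 1 ⬝ᵥ S.zd hd t ψ wd x (k + 1))) :=
    (intervalIntegral_tendsto_integral_Ioi 0 (Integrable.one_dotProduct hint) ht.2.2.2).add
      hsum.hasSum.tendsto_sum_nat
  exact le_of_tendsto' hlim hbound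

/-- Between two impulses an unforced nonnegative solution is controlled by its value at the next
impulse: by Grönwall's inequality backward in time, since the delayed term can only increase the
state. -/
theorem exists_one_dotProduct_le (hT : 0 < Tmax) (hTm : Tmin ≤ Tmax)
    (hA : ContinuousOn S.A (Icc 0 Tmax)) (hG : ContinuousOn S.Gc (Icc 0 Tmax))
    (hE : ContinuousOn S.Ec (Icc 0 Tmax))
    (hpos : S.InternallyPositive (rangeDwell Tmin Tmax)) :
    ∃ L : ℝ, 0 < L ∧ ∀ hc hd t φ ψ wd x, 0 < hc → t ∈ rangeDwell Tmin Tmax →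
      S.IsNonnegSolution hc hd t φ ψ (fun _ => 0) wd x →
      ∀ k, ∀ s ∈ Ioc (t k) (t (k + 1)), 1 ⬝ᵥ x s ≤ L * 1 ⬝ᵥ x (t (k + 1)) := by
  obtain ⟨K, hK, hAK⟩ := exists_bound_mulVec hA
  refine ⟨Real.exp (n * K * Tmax), Real.exp_pos _, ?_⟩
  intro hc hd t φ ψ wd x hc0 ht h k s hs
  set b := t (k + 1) with hb
  set y := S.arc hc hd t ψ (fun _ => 0) wd x k with hy
  have hk0 := rangeDwell.nonneg ht k
  have hlt := rangeDwell.lt_succ ht k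
  have hyx : ∀ r ∈ Ioc (t k) b, y r = x r := fun r hr => h.arc_eq hr
  have hsub : ∀ r ∈ Icc s b, r ∈ Ioc (t k) b := fun r hr => ⟨hs.1.trans_le hr.1, hr.2⟩
  have hyc : ContinuousOn (fun r => 1 ⬝ᵥ y r) (Icc s b) := by
    have : ContinuousOn y (Icc s b) :=
      (h.continuousOn_arc ht k).mono fun r hr => Ioc_subset_Icc_self (hsub r hr)
    simp only [one_dotProduct]
    exact continuousOn_finsetSum _ fun i _ => continuousOn_pi.1 this i
  have hfi := h.flow_integrable k
  have key := le_mul_exp_of_le_integral_backward (q := fun r => 1 ⬝ᵥ y r) (c := 1 ⬝ᵥ x b)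
    (K := n * K) (by positivity) hyc ?_ s ⟨le_rfl, hs.2⟩
  · rw [hyx s hs] at key
    refine key.trans ?_
    rw [mul_comm]
    have hx0 : 0 ≤ 1 ⬝ᵥ x b := one_dotProduct_nonneg (h.state_nonneg _ (rangeDwell.nonneg ht _))
    gcongr
    have := (ht.2.2.1 k).2
    linarith [hs.1]
  intro r hr
  have hrI := hsub r hr
  have hfr : IntervalIntegrable (S.flow hc t (fun _ => 0) x k) volume r b := by
    refine hfi.mono_set ?_
    rw [uIcc_of_le hlt.le]
    exact uIcc_subset_Icc (Ioc_subset_Icc_self hrI) (right_mem_Icc.2 hlt.le)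
  have hfr' : IntervalIntegrable (S.flow hc t (fun _ => 0) x k) volume (t k) r := by
    refine hfi.mono_set ?_
    rw [uIcc_of_le hlt.le]
    exact uIcc_subset_Icc (left_mem_Icc.2 hlt.le) (Ioc_subset_Icc_self hrI)
  have hinc : y b = y r + ∫ u in r..b, S.flow hc t (fun _ => 0) x k u := by
    simp only [hy, arc]
    rw [add_assoc, intervalIntegral.integral_add_adjacent_intervals hfr' hfr]
  have hinc1 : 1 ⬝ᵥ x b = 1 ⬝ᵥ y r + ∫ u in r..b, 1 ⬝ᵥ S.flow hc t (fun _ => 0) x k u := by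
    rw [← hyx b ⟨hlt, le_rfl⟩, hinc, dotProduct_add]
    congr 1
    simp only [one_dotProduct]
    rw [intervalIntegral.integral_finsetSum fun i _ => hfr.eval i]
    exact Finset.sum_congr rfl fun i _ => intervalIntegral_eval hfr i
  have hyi : IntervalIntegrable (fun u => n * K * 1 ⬝ᵥ y u) volume r b := by
    refine (ContinuousOn.intervalIntegrable ?_).const_mul _
    rw [uIcc_of_le hr.2]
    exact hyc.mono (Icc_subset_Icc_left hr.1)
  have hlow : -(∫ u in r..b, n * K * 1 ⬝ᵥ y u) ≤
      ∫ u in r..b, 1 ⬝ᵥ S.flow hc t (fun _ => 0) x k u := by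
    rw [← intervalIntegral.integral_neg]
    refine intervalIntegral.integral_mono_on hr.2 hyi.neg hfr.one_dotProduct fun u hu => ?_
    have huI : u ∈ Ioc (t k) b := ⟨hrI.1.trans_le hu.1, hu.2⟩
    have hmem := rangeDwell.sub_mem ht (Ioc_subset_Icc_self huI)
    have hu0 : 0 < u := hk0.trans_lt huI.1
    have hxu := h.state_nonneg u hu0.le
    have h1 : 0 ≤ 1 ⬝ᵥ (S.Gc (u - t k) *ᵥ x (u - hc)) :=
      one_dotProduct_nonneg fun j => dotProduct_nonneg_of_nonneg
        (fun i => hpos.Gc_nonneg hA hG hE hT hTm hmem j i) (h.nonneg (by linarith))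
    have h2 : -(n * K * 1 ⬝ᵥ x u) ≤ 1 ⬝ᵥ (S.A (u - t k) *ᵥ x u) := by
      have e1 : ∀ v : Fin n → ℝ, -(n * ‖v‖) ≤ 1 ⬝ᵥ v := fun v => by
        have := dotProduct_le_sum_mul_norm (u := 1) (v := -v) zero_le_one
        simp only [dotProduct_neg, norm_neg, Pi.one_apply, Finset.sum_const, Finset.card_univ,
          Fintype.card_fin, nsmul_eq_mul, mul_one] at this
        linarith
      have e2 := e1 (S.A (u - t k) *ᵥ x u)
      have e3 := (hAK _ hmem (x u)).trans
        (mul_le_mul_of_nonneg_left (norm_le_one_dotProduct hxu) hK)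
      have e4 := mul_le_mul_of_nonneg_left e3 (Nat.cast_nonneg (α := ℝ) n)
      linarith
    simp only [flow, Matrix.mulVec_zero, add_zero, dotProduct_add, hyx u huI]
    linarith
  rw [intervalIntegral.integral_const_mul] at hlow
  linarith

/-- Boundedness and convergence of unforced nonnegative solutions: the samples at the impulse times are
summable, and dominate the state in between. -/
theorem IsNonnegSolution.norm_le {C L : ℝ}
    (h : S.IsNonnegSolution hc hd t φ ψ (fun _ => 0) (fun _ => 0) x) (hc0 : 0 < hc)
    (ht : t ∈ rangeDwell Tmin Tmax) (hε : 0 < ε)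
    (hC : S.DissipationBound hc hd ε γ C t φ ψ (fun _ => 0) (fun _ => 0) x) (hC0 : 0 ≤ C)
    (hL0 : 0 < L)
    (hL : ∀ k, ∀ s ∈ Ioc (t k) (t (k + 1)), 1 ⬝ᵥ x s ≤ L * 1 ⬝ᵥ x (t (k + 1))) :
    (∀ s, 0 ≤ s → ‖x s‖ ≤ (L * C / ε + 1) * initNorm hc hd φ ψ) ∧ Tendsto x atTop (𝓝 0) := by
  have ht0 := rangeDwell.nonneg ht
  have hI := initNorm_nonneg hc hd φ ψ
  have hx0 : ∀ k, 0 ≤ 1 ⬝ᵥ x (t (k + 1)) := fun k =>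
    one_dotProduct_nonneg (h.state_nonneg _ (ht0 _))
  have hsum : ∀ K, ∑ k ∈ Finset.range K, 1 ⬝ᵥ x (t (k + 1)) ≤
      C * initNorm hc hd φ ψ / ε := by
    intro K
    have h1 := hC K
    have h2 : 0 ≤ ∑ k ∈ Finset.range K, 1 ⬝ᵥ S.zd hd t ψ (fun _ => 0) x (k + 1) :=
      Finset.sum_nonneg fun k _ => one_dotProduct_nonneg (h.zd_nonneg (k + 1) (by omega))
    have h3 : 0 ≤ ∫ r in (0:ℝ)..(t K), 1 ⬝ᵥ S.zc hc (fun _ => 0) x r := by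
      rw [intervalIntegral.integral_of_le (ht0 K)]
      exact setIntegral_nonneg measurableSet_Ioc fun r hr =>
        one_dotProduct_nonneg (h.zc_nonneg r hr.1)
    simp only [dotProduct_zero, intervalIntegral.integral_zero, Finset.sum_const_zero, add_zero,
      mul_zero, zero_add] at h1
    rw [le_div_iff₀ hε]
    linarith
  have hnorm : ∀ k, ∀ s ∈ Ioc (t k) (t (k + 1)), ‖x s‖ ≤ L * 1 ⬝ᵥ x (t (k + 1)) :=
    fun k s hs => (norm_le_one_dotProduct (h.state_nonneg s ((ht0 k).trans hs.1.le))).trans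
      (hL k s hs)
  refine ⟨fun s hs => ?_, ?_⟩
  · rcases hs.eq_or_lt with rfl | hs
    · have hmem : (0:ℝ) ∈ Icc (-hc) 0 := ⟨by linarith, le_rfl⟩
      rw [h.init 0 hmem]
      refine (norm_le_initNorm hd ψ h.phi_cont hmem).trans ?_
      have : 0 ≤ L * C / ε := by positivity
      nlinarith
    · obtain ⟨k, hk⟩ := rangeDwell.exists_mem_Ioc ht hs
      have h1 : 1 ⬝ᵥ x (t (k + 1)) ≤ C * initNorm hc hd φ ψ / ε :=
        (Finset.single_le_sum (f := fun k => 1 ⬝ᵥ x (t (k + 1))) (fun j _ => hx0 j)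
          (Finset.self_mem_range_succ k)).trans (hsum (k + 1))
      calc ‖x s‖ ≤ L * 1 ⬝ᵥ x (t (k + 1)) := hnorm k s hk
        _ ≤ L * (C * initNorm hc hd φ ψ / ε) := by gcongr
        _ = L * C / ε * initNorm hc hd φ ψ := by ring
        _ ≤ _ := by gcongr; linarith
  · have hlim : Tendsto (fun k => 1 ⬝ᵥ x (t (k + 1))) atTop (𝓝 0) :=
      (summable_of_sum_range_le hx0 hsum).tendsto_atTop_zero
    rw [Metric.tendsto_atTop]
    intro η hη
    obtain ⟨N, hN⟩ := (hlim.eventually_lt_const (div_pos hη hL0)).exists_forall_of_atTop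
    refine ⟨t N + 1, fun s hs => ?_⟩
    obtain ⟨k, hk⟩ := rangeDwell.exists_mem_Ioc ht (s := s) (by linarith [ht0 N])
    have hNk : N ≤ k := by
      have : t N < t (k + 1) := by linarith [hk.2]
      have := (rangeDwell.strictMono ht).lt_iff_lt.1 this
      omega
    rw [dist_zero_right]
    refine (hnorm k s hk).trans_lt ?_
    have := hN k hNk
    rwa [lt_div_iff₀ hL0, mul_comm] at this

end Sys

namespace Sys

variable {n pc pd qc qd : ℕ} {S : Sys n pc pd qc qd} {Tmin Tmax hc ε γ : ℝ}
  {ζ ζ' μc : ℝ → Fin n → ℝ}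

theorem Certificate.asymptoticallyStable (cert : S.Certificate Tmin Tmax ζ ζ' μc ε γ)
    (hTmin : 0 ≤ Tmin) (hT : Tmin ≤ Tmax) (hA : ContinuousOn S.A (Icc 0 Tmax))
    (hG : ContinuousOn S.Gc (Icc 0 Tmax)) (hE : ContinuousOn S.Ec (Icc 0 Tmax))
    (hpos : S.InternallyPositive (rangeDwell Tmin Tmax)) (hε : 0 < ε) (hc0 : 0 < hc) (hd : ℕ)
    {𝒯 : Set (ℕ → ℝ)} (h𝒯 : 𝒯 ⊆ rangeDwell Tmin Tmax)
    (hμ : ∀ t ∈ 𝒯, μc ∈ timerScalings n Tmax hc t) : S.AsymptoticallyStable hc hd 𝒯 := by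
  rcases 𝒯.eq_empty_or_nonempty with rfl | ⟨t₀, ht₀⟩
  · exact ⟨fun e he => ⟨1, one_pos, by simp⟩, by simp⟩
  have hT0 := rangeDwell.Tmax_pos (h𝒯 ht₀)
  obtain ⟨C, hC0, hC⟩ :=
    cert.exists_dissipation_bound hA hG hE hpos (hTmin.trans hT) hc0 hd
  obtain ⟨L, hL0, hL⟩ := exists_one_dotProduct_le hT0 hT hA hG hE hpos
  set D := L * C / ε + 1 with hD
  have hD0 : 0 < D := by positivity
  have main : ∀ t ∈ 𝒯, ∀ φ ψ x, S.IsSolution hc hd t φ ψ (fun _ => 0) (fun _ => 0) x →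
      (∀ s, 0 ≤ s → ‖x s‖ ≤ 2 * D * initNorm hc hd φ ψ) ∧ Tendsto x atTop (𝓝 0) := by
    intro t htT φ ψ x hx
    have ht := h𝒯 htT
    obtain ⟨x₁, x₂, h₁, h₂, rfl⟩ := hx.exists_sub_eq hA hG hE hpos ht hc0
      ((locallyIntegrable_const (0 : Fin pc → ℝ)).locallyIntegrableOn _)
    have e1 : (fun _ => 0 : ℝ → Fin pc → ℝ)⁺ = fun _ => 0 := posPart_zero
    have e2 : (fun _ => 0 : ℝ → Fin pc → ℝ)⁻ = fun _ => 0 := negPart_zero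
    have e3 : (fun _ => 0 : ℕ → Fin pd → ℝ)⁺ = fun _ => 0 := posPart_zero
    have e4 : (fun _ => 0 : ℕ → Fin pd → ℝ)⁻ = fun _ => 0 := negPart_zero
    rw [e1, e3] at h₁
    rw [e2, e4] at h₂
    obtain ⟨a₁, b₁⟩ := h₁.norm_le hc0 ht hε (hC t ht (hμ t htT) _ _ _ _ _ h₁) hC0 hL0
      (hL _ _ _ _ _ _ _ hc0 ht h₁)
    obtain ⟨a₂, b₂⟩ := h₂.norm_le hc0 ht hε (hC t ht (hμ t htT) _ _ _ _ _ h₂) hC0 hL0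
      (hL _ _ _ _ _ _ _ hc0 ht h₂)
    have i₁ : initNorm hc hd φ⁺ ψ⁺ ≤ initNorm hc hd φ ψ :=
      initNorm_mono hc0 hx.phi_cont (fun s => norm_posPart_le _) fun j => norm_posPart_le _
    have i₂ : initNorm hc hd φ⁻ ψ⁻ ≤ initNorm hc hd φ ψ :=
      initNorm_mono hc0 hx.phi_cont (fun s => norm_negPart_le _) fun j => norm_negPart_le _
    refine ⟨fun s hs => (norm_sub_le _ _).trans ?_, by have := b₁.sub b₂; rwa [sub_zero] at this⟩
    have c₁ := (a₁ s hs).trans (mul_le_mul_of_nonneg_left i₁ hD0.le)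
    have c₂ := (a₂ s hs).trans (mul_le_mul_of_nonneg_left i₂ hD0.le)
    linarith
  refine ⟨fun e he => ⟨e / (2 * D), by positivity, ?_⟩, fun t ht φ ψ x hx => (main t ht φ ψ x hx).2⟩
  intro t ht φ ψ x hx hlt s hs
  refine ((main t ht φ ψ x hx).1 s hs).trans_lt ?_
  rw [lt_div_iff₀ (by positivity)] at hlt
  linarith

theorem Certificate.hasHybridGain (cert : S.Certificate Tmin Tmax ζ ζ' μc ε γ)
    (hT : 0 ≤ Tmax) (hA : ContinuousOn S.A (Icc 0 Tmax))
    (hG : ContinuousOn S.Gc (Icc 0 Tmax)) (hE : ContinuousOn S.Ec (Icc 0 Tmax))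
    (hpos : S.InternallyPositive (rangeDwell Tmin Tmax)) (hε : 0 < ε) (hγ : 0 < γ) (hc0 : 0 < hc)
    (hd : ℕ) {𝒯 : Set (ℕ → ℝ)} (h𝒯 : 𝒯 ⊆ rangeDwell Tmin Tmax)
    (hμ : ∀ t ∈ 𝒯, μc ∈ timerScalings n Tmax hc t) : S.HasHybridGain hc hd 𝒯 γ := by
  obtain ⟨C, hC0, hC⟩ := cert.exists_dissipation_bound hA hG hE hpos hT hc0 hd
  have hC1 : 0 < 2 * C + 1 := by positivity
  -- `2 C`, since both parts of the initial data contribute; the `1` makes `v` strictly increasing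
  -- when `C = 0`.
  refine ⟨fun s => (2 * C + 1) * s, fun a _ b _ hab => mul_lt_mul_of_pos_left hab hC1,
    mul_zero _, tendsto_id.const_mul_atTop hC1, ?_⟩
  intro t htT φ ψ wc wd x hx hw hwd
  have ht := h𝒯 htT
  have hwl : LocallyIntegrableOn wc (Ici 0) :=
    ((integrableOn_Ici_iff_integrableOn_Ioi (by finiteness)).2 hw).locallyIntegrableOn
  obtain ⟨x₁, x₂, h₁, h₂, rfl⟩ := hx.exists_sub_eq hA hG hE hpos ht hc0 hwl
  have hwp := integrable_posPart hw
  have hwn := integrable_negPart hw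
  have hdp : Summable fun k => 1 ⬝ᵥ wd⁺ (k + 1) :=
    Summable.of_nonneg_of_le (fun k => one_dotProduct_nonneg (posPart_nonneg (wd (k + 1))))
      (fun k => by
        rw [norm1_eq_posPart_add_negPart]
        exact le_add_of_nonneg_right (one_dotProduct_nonneg (negPart_nonneg (wd (k + 1))))) hwd
  have hdn : Summable fun k => 1 ⬝ᵥ wd⁻ (k + 1) :=
    Summable.of_nonneg_of_le (fun k => one_dotProduct_nonneg (negPart_nonneg (wd (k + 1))))
      (fun k => by
        rw [norm1_eq_posPart_add_negPart]
        exact le_add_of_nonneg_left (one_dotProduct_nonneg (posPart_nonneg (wd (k + 1))))) hwd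
  obtain ⟨p₁, q₁, r₁⟩ := h₁.gain hc0 ht hε hγ (hC t ht (hμ t htT) _ _ _ _ _ h₁) hwp hdp
  obtain ⟨p₂, q₂, r₂⟩ := h₂.gain hc0 ht hε hγ (hC t ht (hμ t htT) _ _ _ _ _ h₂) hwn hdn
  have i₁ : initNorm hc hd φ⁺ ψ⁺ ≤ initNorm hc hd φ ψ :=
    initNorm_mono hc0 hx.phi_cont (fun s => norm_posPart_le _) fun j => norm_posPart_le _
  have i₂ : initNorm hc hd φ⁻ ψ⁻ ≤ initNorm hc hd φ ψ :=
    initNorm_mono hc0 hx.phi_cont (fun s => norm_negPart_le _) fun j => norm_negPart_le _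
  have hzc : S.zc hc wc (x₁ - x₂) = S.zc hc wc⁺ x₁ - S.zc hc wc⁻ x₂ := by
    ext1 s
    conv_lhs => rw [← posPart_sub_negPart wc]
    exact zc_sub S hc _ _ _ _ s
  have hzd : ∀ k, S.zd hd t ψ wd (x₁ - x₂) k = S.zd hd t ψ⁺ wd⁺ x₁ k - S.zd hd t ψ⁻ wd⁻ x₂ k := by
    intro k
    conv_lhs => rw [← posPart_sub_negPart wd, ← posPart_sub_negPart ψ]
    exact zd_sub S hd t _ _ _ _ _ _ k
  have hzci : IntegrableOn (S.zc hc wc (x₁ - x₂)) (Ioi 0) := by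
    rw [hzc]; exact p₁.sub p₂
  have hzd1 : ∀ k, norm1 (S.zd hd t ψ wd (x₁ - x₂) (k + 1)) ≤
      1 ⬝ᵥ S.zd hd t ψ⁺ wd⁺ x₁ (k + 1) + 1 ⬝ᵥ S.zd hd t ψ⁻ wd⁻ x₂ (k + 1) := fun k => by
    rw [hzd]
    exact norm1_sub_le (h₁.zd_nonneg _ (by omega)) (h₂.zd_nonneg _ (by omega))
  have hzds : Summable fun k => norm1 (S.zd hd t ψ wd (x₁ - x₂) (k + 1)) :=
    Summable.of_nonneg_of_le (fun k => norm1_nonneg _) hzd1 (q₁.add q₂)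
  refine ⟨hzci, hzds, ?_⟩
  have s₁ : ∫ s in Ioi 0, norm1 (S.zc hc wc (x₁ - x₂) s) ≤
      (∫ s in Ioi 0, 1 ⬝ᵥ S.zc hc wc⁺ x₁ s) + ∫ s in Ioi 0, 1 ⬝ᵥ S.zc hc wc⁻ x₂ s := by
    rw [← integral_add p₁.one_dotProduct p₂.one_dotProduct]
    refine setIntegral_mono_on (integrable_norm1 hzci)
      (p₁.one_dotProduct.add p₂.one_dotProduct) measurableSet_Ioi fun s hs => ?_
    rw [hzc]
    exact norm1_sub_le (h₁.zc_nonneg s hs) (h₂.zc_nonneg s hs)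
  have s₂ : ∑' k, norm1 (S.zd hd t ψ wd (x₁ - x₂) (k + 1)) ≤
      ∑' k, 1 ⬝ᵥ S.zd hd t ψ⁺ wd⁺ x₁ (k + 1) + ∑' k, 1 ⬝ᵥ S.zd hd t ψ⁻ wd⁻ x₂ (k + 1) := by
    rw [← q₁.tsum_add q₂]
    exact hzds.tsum_le_tsum hzd1 (q₁.add q₂)
  have s₃ : ∫ s in Ioi 0, norm1 (wc s) =
      (∫ s in Ioi 0, 1 ⬝ᵥ wc⁺ s) + ∫ s in Ioi 0, 1 ⬝ᵥ wc⁻ s := by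
    rw [← integral_add hwp.one_dotProduct hwn.one_dotProduct]
    exact integral_congr_ae (Eventually.of_forall fun s => norm1_eq_posPart_add_negPart (wc s))
  have s₄ : ∑' k, norm1 (wd (k + 1)) = ∑' k, 1 ⬝ᵥ wd⁺ (k + 1) + ∑' k, 1 ⬝ᵥ wd⁻ (k + 1) := by
    rw [← hdp.tsum_add hdn]
    exact tsum_congr fun k => norm1_eq_posPart_add_negPart (wd (k + 1))
  have c₁ := mul_le_mul_of_nonneg_left i₁ hC0
  have c₂ := mul_le_mul_of_nonneg_left i₂ hC0
  have hI := initNorm_nonneg hc hd φ ψ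
  rw [s₃, s₄]
  linarith

end Sys

end DelayImpulsive

theorem mainTheorem5 {n pc pd qc qd : ℕ} (S : DelayImpulsive.Sys n pc pd qc qd)
    (Tmin Tmax : ℝ) (hTmin : 0 ≤ Tmin) (hT : Tmin ≤ Tmax)
    (hA : ContinuousOn S.A (Icc 0 Tmax)) (hG : ContinuousOn S.Gc (Icc 0 Tmax))
    (hE : ContinuousOn S.Ec (Icc 0 Tmax))
    (hpos : S.InternallyPositive (DelayImpulsive.rangeDwell Tmin Tmax))
    (ζ ζ' μc : ℝ → Fin n → ℝ) (ε γ : ℝ) (hε : 0 < ε) (hγ : 0 < γ)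
    (hζ : ∀ τ ∈ Icc 0 Tmax, HasDerivWithinAt ζ (ζ' τ) (Icc 0 Tmax) τ)
    (hζ0 : ∀ i, 0 < ζ 0 i)
    (hc1 : ∀ τ ∈ Icc 0 Tmax, ζ' τ + ζ τ ᵥ* S.A τ + μc τ + 1 ᵥ* S.Cc ≤ 0)
    (hc2 : ∀ τ ∈ Icc 0 Tmax, ζ τ ᵥ* S.Gc τ - μc τ + 1 ᵥ* S.Hc ≤ 0)
    (hc3 : ∀ τ ∈ Icc 0 Tmax, ζ τ ᵥ* S.Ec τ + 1 ᵥ* S.Fc ≤ fun _ => γ)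
    (hd1 : ∀ θ ∈ Icc Tmin Tmax,
      -ζ θ + ζ 0 ᵥ* (S.J + S.Gd) + 1 ᵥ* (S.Cd + S.Hd) ≤ fun _ => -ε)
    (hd2 : ζ 0 ᵥ* S.Ed + 1 ᵥ* S.Fd ≤ fun _ => γ) :
    ∀ hc : ℝ, 0 < hc → ∀ hd : ℕ,
      ∀ 𝒯 : Set (ℕ → ℝ), 𝒯 ⊆ DelayImpulsive.rangeDwell Tmin Tmax →
        (∀ t ∈ 𝒯, μc ∈ DelayImpulsive.timerScalings n Tmax hc t) →
        S.AsymptoticallyStable hc hd 𝒯 ∧ S.HasHybridGain hc hd 𝒯 γ := by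
  intro hc hc0 hd 𝒯 h𝒯 hμ
  have cert : S.Certificate Tmin Tmax ζ ζ' μc ε γ := ⟨hζ, hζ0, hc1, hc2, hc3, hd1, hd2⟩
  exact ⟨cert.asymptoticallyStable hTmin hT hA hG hE hpos hε hc0 hd h𝒯 hμ,
    cert.hasHybridGain (hTmin.trans hT) hA hG hE hpos hε hγ hc0 hd h𝒯 hμ⟩
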